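/- Let $(N,G)$ be a closed (compact, boundaryless) smooth Riemannian manifold and let $E_0\ge 0$. Write $\mathscr C(a,b)=(a,b)\times S^1$ (with $S^1=\mathbb R/2\pi\mathbb Z$) with the flat metric $ds^2+d\theta^2$, and $\mathscr C_\Lambda=\mathscr C(-\Lambda,\Lambda)$. Then there exist $\delta>0$ and $C\in(0,\infty)$, depending only on $(N,G)$ and $E_0$, such that the following holds for every isometric embedding $N\hookrightarrow\mathbb R^{N_0}$ (any $N_0$), every $\Lambda\ge \tfrac32$ and every smooth map $u:\mathscr C_\Lambda\to N\hookrightarrow\mathbb R^{N_0}$ with $E(u;\mathscr C_\Lambda)\le E_0$. Here $$E(u;\mathscr C(a,b))=\tfrac12\int_{\mathscr C(a,b)}\big(|u_s|^2+|u_\theta|^2\big)\,ds\,d\theta,\qquad \tau=u_{\theta\theta}+u_{ss}+A(u)(u_s,u_s)+A(u)(u_\theta,u_\theta),$$ where $A$ is the second fundamental form of $N\hookrightarrow\mathbb R^{N_0}$, with the sign $A(X,Y)=-(D_XY)^\perp$ (so that $\tau$ is the tension of $u$, the tangential part of $u_{ss}+u_{\theta\theta}$), and $$\vartheta(s)=\int_{\{s\}\times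 S^1}|u_\theta|^2\,d\theta,\qquad \mathcal T(s)=\int_{\{s\}\times S^1}|\tau|^2\,d\theta,$$ $$\Phi=\big(|u_s|^2-|u_\theta|^2-2i\langle u_s,u_\theta\rangle\big)\,dz^2\ \ (z=s+i\theta),\qquad \|\varphi\,dz^2\|_{L^1(\mathscr C(a,b))}=2\int_{\mathscr C(a,b)}|\varphi|\,ds\,d\theta .$$ If $$E(u;\mathscr C(s-1,s+2))<\delta\quad\text{for every } s \text{ such that } \mathscr C(s-1,s+2)\subset\mathscr C_\Lambda,\qquad\text{and}\qquad \|\tau\|^2_{L^2(\mathscr C_\Lambda)}<\delta,$$ then for every $s\in(-\Lambda+1,\Lambda-1)$ $$\vartheta(s)\le C e^{|s|-\Lambda}+\int_{-\Lambda}^{\Lambda}e^{-|s-q|}\,\mathcal T(q)\,dq .$$ Furthermore, whenever $1<\lambda<\Lambda$, $$\int_{-\Lambda+\lambda}^{\Lambda-\lambda}\vartheta(s)\,ds\le C e^{-\lambda}+2\|\tau\|^2_{L^2(\mathscr C_\Lambda)}$$ and $$E(u;\mathscr C_{\Lambda-\lambda})\le C e^{-\lambda}+2\|\tau\|^2_{L^2(\mathscr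 C_\Lambda)}+\tfrac14\|\Phi\|_{L^1(\mathscr C_{\Lambda-\lambda})}.$$ -/

import Mathlib

open Set
open scoped Manifold ContDiff ENNReal NNReal

noncomputable section

namespace AlmostHarmonicCylinder

/-- The finite cylinder `𝒞(a,b) = (a,b) × S¹`. -/
def cylinder (a b : ℝ) : Set (ℝ × Circle) := Ioo a b ×ˢ univ

/-- Partial derivative in the length coordinate `s` of a function of the coordinates `(s, θ)`. -/
def derivS {E : Type*} [NormedAddCommGroup E] [NormedSpace ℝ E] (f : ℝ → ℝ → E) (s θ : ℝ) : E :=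
  deriv (fun s' => f s' θ) s

/-- Partial derivative in the angular coordinate `θ` of a function of the coordinates `(s, θ)`. -/
def derivTheta {E : Type*} [NormedAddCommGroup E] [NormedSpace ℝ E]
    (f : ℝ → ℝ → E) (s θ : ℝ) : E :=
  deriv (fun θ' => f s θ') θ

/-- `∫_{{s} × S¹} f`, for a nonnegative function `f` written in the coordinates `(s, θ)`. -/
def circleInt (f : ℝ → ℝ → ℝ≥0∞) (s : ℝ) : ℝ≥0∞ :=
  ∫⁻ θ in Ioc 0 (2 * Real.pi), f s θ

/-- `∫_{𝒞(a,b)} f ds dθ`, for a nonnegative function `f` written in the coordinates `(s, θ)`. -/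
def cylInt (f : ℝ → ℝ → ℝ≥0∞) (a b : ℝ) : ℝ≥0∞ :=
  ∫⁻ s in Ioo a b, circleInt f s

section Target

variable {n k : ℕ} {N : Type*} [TopologicalSpace N] [ChartedSpace (EuclideanSpace ℝ (Fin n)) N]

/-- The differential `dι_p : T_p N → ℝᵏ` of a map `ι : N → ℝᵏ`. -/
def differential (ι : N → EuclideanSpace ℝ (Fin k)) (p : N) :
    TangentSpace (𝓡 n) p →L[ℝ] EuclideanSpace ℝ (Fin k) :=
  mfderiv (𝓡 n) (𝓡 k) ι p

/-- `ι` is an isometric embedding of the Riemannian manifold `(N, G)` into Euclidean space `ℝᵏ`. -/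
structure IsIsometricEmbedding [IsManifold (𝓡 n) ∞ N]
    (G : Bundle.ContMDiffRiemannianMetric (𝓡 n) ∞ (EuclideanSpace ℝ (Fin n))
      (fun x : N => TangentSpace (𝓡 n) x))
    (ι : N → EuclideanSpace ℝ (Fin k)) : Prop where
  isSmoothEmbedding : Manifold.IsSmoothEmbedding (𝓡 n) (𝓡 k) ∞ ι
  isometric : ∀ (p : N) (X Y : TangentSpace (𝓡 n) p),
    inner ℝ (differential ι p X) (differential ι p Y) = G.inner p X Y

/-- The tangent space of `N` at `p`, as a linear subspace `dι(T_p N)` of `ℝᵏ`. -/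
def tangentSubspace (ι : N → EuclideanSpace ℝ (Fin k)) (p : N) :
    Submodule ℝ (EuclideanSpace ℝ (Fin k)) :=
  LinearMap.range (differential (n := n) ι p).toLinearMap

/-- The orthogonal projection `P_p` of `ℝᵏ` onto the tangent space of `N` at `p`. -/
def tangentProj (ι : N → EuclideanSpace ℝ (Fin k)) (p : N) :
    EuclideanSpace ℝ (Fin k) →L[ℝ] EuclideanSpace ℝ (Fin k) :=
  (tangentSubspace (n := n) ι p).starProjection

/-- The second fundamental form `A(p)` of `N ↪ ℝᵏ`, as a function of tangent vectors `X, Y ∈ T_p N`.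
It is `A(p)(X, Y) = -(D_X P)(Y)`. For any extension of `Y` to a tangential vector field one has
`P Y = Y`, hence `(D_X P)(Y) = (1 - P)(D_X Y)`, so `A(p)(X, Y)` is minus the normal component of
`D_X Y`; this is the sign for which `u_ss + u_θθ + A(u)(u_s, u_s) + A(u)(u_θ, u_θ)` is
tangential, i.e. is the tension `tr ∇du`. -/
def secondFundForm (ι : N → EuclideanSpace ℝ (Fin k)) (p : N) (X Y : TangentSpace (𝓡 n) p) :
    EuclideanSpace ℝ (Fin k) :=
  -(differential (fun q : N => tangentProj (n := n) ι q (differential ι p Y)) p X)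

/-- The map `u`, as a map into `ℝᵏ`, in the coordinates `(s, θ)` of the cylinder. -/
def coordMap (ι : N → EuclideanSpace ℝ (Fin k)) (u : ℝ × Circle → N) (s θ : ℝ) :
    EuclideanSpace ℝ (Fin k) :=
  ι (u (s, Circle.exp θ))

/-- `u_s` as a tangent vector of `N`. -/
def tangentS (u : ℝ × Circle → N) (s θ : ℝ) : TangentSpace (𝓡 n) (u (s, Circle.exp θ)) :=
  mfderiv 𝓘(ℝ, ℝ) (𝓡 n) (fun s' : ℝ => u (s', Circle.exp θ)) s (1 : ℝ)

/-- `u_θ` as a tangent vector of `N`. -/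
def tangentTheta (u : ℝ × Circle → N) (s θ : ℝ) : TangentSpace (𝓡 n) (u (s, Circle.exp θ)) :=
  mfderiv 𝓘(ℝ, ℝ) (𝓡 n) (fun θ' : ℝ => u (s, Circle.exp θ')) θ (1 : ℝ)

/-- The tension `τ = u_θθ + u_ss + A(u)(u_s, u_s) + A(u)(u_θ, u_θ)` with respect to the flat metric
`ds² + dθ²`. -/
def tension (ι : N → EuclideanSpace ℝ (Fin k)) (u : ℝ × Circle → N) (s θ : ℝ) :
    EuclideanSpace ℝ (Fin k) :=
  derivTheta (derivTheta (coordMap ι u)) s θ + derivS (derivS (coordMap ι u)) s θ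
    + secondFundForm (n := n) ι (u (s, Circle.exp θ)) (tangentS u s θ) (tangentS u s θ)
    + secondFundForm (n := n) ι (u (s, Circle.exp θ)) (tangentTheta u s θ) (tangentTheta u s θ)

end Target

section Quantities

variable {k : ℕ} {N : Type*}

/-- The energy `E(u; 𝒞(a,b)) = ½ ∫ (|u_s|² + |u_θ|²) ds dθ`, with values in `[0, ∞]`. -/
def energy (ι : N → EuclideanSpace ℝ (Fin k)) (u : ℝ × Circle → N) (a b : ℝ) : ℝ≥0∞ :=
  2⁻¹ * cylInt (fun s θ =>
    ‖derivS (coordMap ι u) s θ‖ₑ ^ 2 + ‖derivTheta (coordMap ι u) s θ‖ₑ ^ 2) a b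

/-- The angular energy `ϑ(s) = ∫_{{s} × S¹} |u_θ|²`. -/
def angularEnergy (ι : N → EuclideanSpace ℝ (Fin k)) (u : ℝ × Circle → N) (s : ℝ) : ℝ≥0∞ :=
  circleInt (fun s θ => ‖derivTheta (coordMap ι u) s θ‖ₑ ^ 2) s

/-- The coefficient `φ = |u_s|² - |u_θ|² - 2i⟨u_s, u_θ⟩` of the Hopf differential `Φ = φ dz²`,
`z = s + iθ`. -/
def hopfCoeff (ι : N → EuclideanSpace ℝ (Fin k)) (u : ℝ × Circle → N) (s θ : ℝ) : ℂ :=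
  ((‖derivS (coordMap ι u) s θ‖ ^ 2 - ‖derivTheta (coordMap ι u) s θ‖ ^ 2 : ℝ) : ℂ)
    - 2 * Complex.I * ((inner ℝ (derivS (coordMap ι u) s θ) (derivTheta (coordMap ι u) s θ) : ℝ) : ℂ)

/-- `‖Φ‖_{L¹(𝒞(a,b))} = 2 ∫ |φ| ds dθ`, because `|dz²| = 2` in the flat metric. -/
def hopfL1 (ι : N → EuclideanSpace ℝ (Fin k)) (u : ℝ × Circle → N) (a b : ℝ) : ℝ≥0∞ :=
  2 * cylInt (fun s θ => ‖hopfCoeff ι u s θ‖ₑ) a b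

variable {n : ℕ} [TopologicalSpace N] [ChartedSpace (EuclideanSpace ℝ (Fin n)) N]

/-- `𝒯(s) = ∫_{{s} × S¹} |τ|²`. -/
def tensionCircle (ι : N → EuclideanSpace ℝ (Fin k)) (u : ℝ × Circle → N) (s : ℝ) : ℝ≥0∞ :=
  circleInt (fun s θ => ‖tension (n := n) ι u s θ‖ₑ ^ 2) s

/-- `‖τ‖²_{L²(𝒞(a,b))}`. -/
def tensionL2Sq (ι : N → EuclideanSpace ℝ (Fin k)) (u : ℝ × Circle → N) (a b : ℝ) : ℝ≥0∞ :=
  cylInt (fun s θ => ‖tension (n := n) ι u s θ‖ₑ ^ 2) a b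

end Quantities

end AlmostHarmonicCylinder

end

noncomputable section

namespace AlmostHarmonicCylinder

open MeasureTheory intervalIntegral

/-! Write ϑ for the angular energy, T for the circle integral of |τ|², A = ∫|u_sθ|² and B = ∫|u_θθ|²
over a circle. The goal is the differential inequality ϑ'' ≥ ϑ - 2T. The kernel integral I(s) = ∫
e^{-|s-q|} T(q) dq satisfies I'' = I - 2T, and a multiple of cosh satisfies y'' = y, so the maximum
principle (`le_cosh_add_integral_of_le_second_derivative`) bounds ϑ by their sum. This gives the
pointwise decay. Integrating it in s by Tonelli, with ∫ e^{-|s-q|} ds = 2, gives the second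
estimate; the third follows from the pointwise inequality |u_s|² + |u_θ|² ≤ 2|u_θ|² + |φ|.

To find ϑ'', integrate by parts in θ: ϑ'' = 2A - 2∫⟨u_θθ, u_ss⟩. Here u_ss = τ - u_θθ + ν with ν
normal to N. Pairing with ν sees only the normal part of u_θθ, which the second fundamental form
bounds by K|u_θ|², so the error is at most K²|u_θ|²(|u_s|² + |u_θ|²). Wirtinger's inequality yields
sup |u_θ|² ≤ 3√(ϑB), and the error is absorbed into B as soon as ∫(|u_s|² + |u_θ|²) is small on
every single circle (`le_angularDeriv2`).

The hypothesis gives this smallness only after integration in s, and two devices upgrade it to each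
circle. The circle mean of the real part of the Hopf differential, ∫|u_s|² - ϑ, has derivative
2∫⟨u_s, τ⟩, so it is O(δ) everywhere (`abs_hopfMean_le`) and only ϑ remains to be bounded. For ϑ the
same computation gives the closed inequality ϑ'' ≥ A + B - 18M²ϑ(2ϑ + 4δ)² - 2T with M = K², and a
one-dimensional cutoff argument, `le_of_cubic_differential_inequality`, shows ϑ ≤ 52δ. No regularity
theory in two dimensions is needed.

The constants must not depend on the embedding. The norms of u_s, u_θ and τ are intrinsic
(`norm_tension_eq` for the last one), so K can be taken from one fixed isometric embedding,
compactness of N making it finite, and the decay is transferred to every other embedding. -/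

/-! ### One-dimensional differential inequalities. -/

theorem cutoff_integral_by_parts {f f' f'' : ℝ → ℝ} {c : ℝ}
    (hf : ∀ x ∈ Icc (c - 1 / 2) (c + 1 / 2), HasDerivAt f (f' x) x)
    (hf' : ∀ x ∈ Icc (c - 1 / 2) (c + 1 / 2), HasDerivAt f' (f'' x) x)
    (hc : ContinuousOn f'' (Icc (c - 1 / 2) (c + 1 / 2))) :
    ∫ x in (c - 1 / 2)..(c + 1 / 2), (1 - 4 * (x - c) ^ 2) ^ 2 * f'' x =
      ∫ x in (c - 1 / 2)..(c + 1 / 2), (192 * (x - c) ^ 2 - 16) * f x := by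
  have hle : c - 1 / 2 ≤ c + 1 / 2 := by linarith
  have hfc : ContinuousOn f (Icc (c - 1 / 2) (c + 1 / 2)) :=
    fun x hx => (hf x hx).continuousAt.continuousWithinAt
  have h1 : IntervalIntegrable (fun x => (1 - 4 * (x - c) ^ 2) ^ 2 * f'' x) volume
      (c - 1 / 2) (c + 1 / 2) := by
    apply ContinuousOn.intervalIntegrable
    rw [uIcc_of_le hle]
    fun_prop
  have h2 : IntervalIntegrable (fun x => (192 * (x - c) ^ 2 - 16) * f x) volume
      (c - 1 / 2) (c + 1 / 2) := by
    apply ContinuousOn.intervalIntegrable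
    rw [uIcc_of_le hle]
    fun_prop
  -- With η = 1 - 4(x-c)², the primitive is η² f' - (η²)' f. Both boundary terms vanish because η²
  -- has double zeros at the endpoints.
  have key := integral_eq_sub_of_hasDerivAt (a := c - 1 / 2) (b := c + 1 / 2)
    (f := fun x => (1 - 4 * (x - c) ^ 2) ^ 2 * f' x - (-16 * (x - c) * (1 - 4 * (x - c) ^ 2)) * f x)
    (f' := fun x => (1 - 4 * (x - c) ^ 2) ^ 2 * f'' x - (192 * (x - c) ^ 2 - 16) * f x)
    (by
      intro x hx
      rw [uIcc_of_le hle] at hx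
      have hl : HasDerivAt (fun x : ℝ => x - c) 1 x := (hasDerivAt_id x).sub_const c
      have he : HasDerivAt (fun x : ℝ => 1 - 4 * (x - c) ^ 2) (-(8 * (x - c))) x := by
        have := ((hl.pow 2).const_mul 4).const_sub 1
        refine this.congr_deriv ?_
        norm_num; ring
      refine (((he.pow 2).mul (hf' x hx)).sub
        ((((hl.const_mul (-16)).mul he)).mul (hf x hx))).congr_deriv ?_
      norm_num; ring)
    (h1.sub h2)
  rw [integral_sub h1 h2] at key
  have : ∀ z : ℝ, z ^ 2 = 1 / 4 → 1 - 4 * z ^ 2 = 0 := fun z hz => by rw [hz]; norm_num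
  rw [this (c + 1 / 2 - c) (by ring), this (c - 1 / 2 - c) (by ring)] at key
  simp at key
  linarith

/-- The weight e² turns the cubic term into e²f³ ≤ m²f, which is linear in f, so the integral of f
controls it once the maximum m of the cut-off function is known. -/
theorem cutoff_cubic_le {e f f2 D T m M δ : ℝ} (he0 : 0 ≤ e) (he1 : e ≤ 1) (hf : 0 ≤ f)
    (hT : 0 ≤ T) (hm : e * f ≤ m) (h : D - 18 * M ^ 2 * f * (2 * f + 4 * δ) ^ 2 - 2 * T ≤ f2) :
    e ^ 2 * D ≤ e ^ 2 * f2 + 18 * M ^ 2 * (8 * m ^ 2 + 32 * δ ^ 2) * f + 2 * T := by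
  have i1 := mul_le_mul_of_nonneg_left h (sq_nonneg e)
  have i2 : e ^ 2 ≤ 1 := pow_le_one₀ he0 he1
  have i3 : (2 * f + 4 * δ) ^ 2 ≤ 8 * f ^ 2 + 32 * δ ^ 2 := by
    linarith [sq_nonneg (2 * f - 4 * δ)]
  have i4 : e ^ 2 * (2 * f + 4 * δ) ^ 2 ≤ 8 * m ^ 2 + 32 * δ ^ 2 := by
    have j1 : (e * f) ^ 2 ≤ m ^ 2 := pow_le_pow_left₀ (mul_nonneg he0 hf) hm 2
    have j2 : e ^ 2 * δ ^ 2 ≤ 1 * δ ^ 2 := mul_le_mul_of_nonneg_right i2 (sq_nonneg δ)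
    linarith [mul_le_mul_of_nonneg_left i3 (sq_nonneg e)]
  have i5 := mul_le_mul_of_nonneg_left i4 (mul_nonneg (by positivity : 0 ≤ 18 * M ^ 2) hf)
  have i6 : e ^ 2 * T ≤ 1 * T := mul_le_mul_of_nonneg_right i2 hT
  linarith

/-- Young's inequality with a free parameter r, which is optimised only after integration. -/
theorem weighted_derivative_le {e f f' D r : ℝ} (hf : 0 ≤ f) (hD : 0 ≤ D)
    (h : f' ^ 2 ≤ 4 * f * D) (hr : 0 < r) : e * f' ≤ r * f + e ^ 2 * D / r := by
  refine le_of_abs_le (abs_le_of_sq_le_sq ?_ (by positivity))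
  have b1 := mul_le_mul_of_nonneg_left h (sq_nonneg e)
  have b2 : 4 * (r * f) * (e ^ 2 * D / r) ≤ (r * f + e ^ 2 * D / r) ^ 2 := by
    linarith [sq_nonneg (r * f - e ^ 2 * D / r)]
  have b3 : 4 * (r * f) * (e ^ 2 * D / r) = e ^ 2 * (4 * f * D) := by
    field_simp
  rw [mul_pow]; linarith

theorem sq_le_of_forall_le_add_div {m Z δ : ℝ} (hm0 : 0 ≤ m) (hδ : 0 < δ) (hZ : 0 ≤ Z)
    (h : ∀ r : ℝ, 0 < r → m ≤ 8 * δ + 2 * δ * r + Z / r) :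
    m ^ 2 ≤ 256 * δ ^ 2 + 16 * δ * Z := by
  rcases hm0.eq_or_lt with h0 | h0
  · rw [← h0]
    nlinarith [mul_nonneg hδ.le hZ, sq_nonneg δ]
  -- This r makes the term 2δr equal to m/2, which is absorbed on the left.
  have h1 := h (m / (4 * δ)) (by positivity)
  have h2 : 2 * δ * (m / (4 * δ)) = m / 2 := by field_simp; norm_num
  have h3 : Z / (m / (4 * δ)) = 4 * δ * Z / m := by field_simp
  rw [h2, h3] at h1
  have h4 := mul_le_mul_of_nonneg_left h1 h0.le
  have h5 : m * (8 * δ + m / 2 + 4 * δ * Z / m) = 8 * δ * m + m ^ 2 / 2 + 4 * δ * Z := by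
    field_simp
  rw [h5] at h4
  nlinarith [sq_nonneg (m - 16 * δ)]

/-- An `ε`-regularity estimate for the scale-invariant inequality `f'' ≥ D - C f³ - 2T`. -/
theorem le_of_cubic_differential_inequality {f f' f'' D T : ℝ → ℝ} {c M δ : ℝ}
    (hf : ∀ x ∈ Icc (c - 1 / 2) (c + 1 / 2), HasDerivAt f (f' x) x)
    (hf' : ∀ x ∈ Icc (c - 1 / 2) (c + 1 / 2), HasDerivAt f' (f'' x) x)
    (hc : ContinuousOn f'' (Icc (c - 1 / 2) (c + 1 / 2)))
    (hD : ContinuousOn D (Icc (c - 1 / 2) (c + 1 / 2)))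
    (hT : ContinuousOn T (Icc (c - 1 / 2) (c + 1 / 2)))
    (hf0 : ∀ x, 0 ≤ f x) (hD0 : ∀ x, 0 ≤ D x) (hT0 : ∀ x, 0 ≤ T x)
    (hder : ∀ x ∈ Icc (c - 1 / 2) (c + 1 / 2), f' x ^ 2 ≤ 4 * f x * D x)
    (hM : 0 ≤ M) (hδ : 0 < δ) (hMδ : M * δ ≤ 1 / 1296)
    (hineq : ∀ x ∈ Icc (c - 1 / 2) (c + 1 / 2),
      D x - 18 * M ^ 2 * f x * (2 * f x + 4 * δ) ^ 2 - 2 * T x ≤ f'' x)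
    (hfi : ∫ x in (c - 1 / 2)..(c + 1 / 2), f x ≤ 2 * δ)
    (hTi : ∫ x in (c - 1 / 2)..(c + 1 / 2), T x ≤ δ) :
    f c ≤ 52 * δ := by
  have hle : c - 1 / 2 ≤ c + 1 / 2 := by linarith
  have hfc : ContinuousOn f (Icc (c - 1 / 2) (c + 1 / 2)) :=
    fun x hx => (hf x hx).continuousAt.continuousWithinAt
  have hf'c : ContinuousOn f' (Icc (c - 1 / 2) (c + 1 / 2)) :=
    fun x hx => (hf' x hx).continuousAt.continuousWithinAt
  have hint : ∀ g : ℝ → ℝ, ContinuousOn g (Icc (c - 1 / 2) (c + 1 / 2)) →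
      IntervalIntegrable g volume (c - 1 / 2) (c + 1 / 2) := by
    intro g hg
    apply ContinuousOn.intervalIntegrable
    rwa [uIcc_of_le hle]
  set η : ℝ → ℝ := fun x => 1 - 4 * (x - c) ^ 2 with hη
  have hηc : ContinuousOn η (Icc (c - 1 / 2) (c + 1 / 2)) := by fun_prop
  have hsq : ∀ x ∈ Icc (c - 1 / 2) (c + 1 / 2), (x - c) ^ 2 ≤ 1 / 4 := by
    intro x hx
    nlinarith [hx.1, hx.2]
  have hη0 : ∀ x ∈ Icc (c - 1 / 2) (c + 1 / 2), 0 ≤ η x := by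
    intro x hx
    have := hsq x hx
    simp only [hη]; linarith
  have hη1 : ∀ x, η x ≤ 1 := by
    intro x
    simp only [hη]; nlinarith [sq_nonneg (x - c)]
  obtain ⟨y, hy, hymax⟩ := isCompact_Icc.exists_isMaxOn (nonempty_Icc.2 hle) (hηc.mul hfc)
  set m := η y * f y with hm
  have hmmax : ∀ x ∈ Icc (c - 1 / 2) (c + 1 / 2), η x * f x ≤ m := fun x hx => hymax hx
  have hm0 : 0 ≤ m := mul_nonneg (hη0 y hy) (hf0 y)
  set Z := ∫ x in (c - 1 / 2)..(c + 1 / 2), η x ^ 2 * D x with hZ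
  have hZ0 : 0 ≤ Z := integral_nonneg hle fun x _ => mul_nonneg (sq_nonneg _) (hD0 x)
  -- bound of `Z`
  have hZle : Z ≤ 66 * δ + 18 * M ^ 2 * (16 * δ * m ^ 2 + 64 * δ ^ 3) := by
    have hmono : ∫ x in (c - 1 / 2)..(c + 1 / 2), η x ^ 2 * D x ≤
        ∫ x in (c - 1 / 2)..(c + 1 / 2), (η x ^ 2 * f'' x
          + 18 * M ^ 2 * (8 * m ^ 2 + 32 * δ ^ 2) * f x + 2 * T x) := by
      apply integral_mono_on hle
      · exact hint _ (by fun_prop)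
      · exact hint _ (by fun_prop)
      · intro x hx
        exact cutoff_cubic_le (hη0 x hx) (hη1 x) (hf0 x) (hT0 x) (hmmax x hx) (hineq x hx)
    rw [integral_add (hint _ (by fun_prop)) (hint _ (by fun_prop)),
      integral_add (hint _ (by fun_prop)) (hint _ (by fun_prop)),
      cutoff_integral_by_parts hf hf' hc, intervalIntegral.integral_const_mul,
      intervalIntegral.integral_const_mul] at hmono
    -- The second derivative of η² is at most 192/4 - 16 = 32, which contributes 64δ; the tension
    -- term contributes the remaining 2δ of 66δ.
    have hb : ∫ x in (c - 1 / 2)..(c + 1 / 2), (192 * (x - c) ^ 2 - 16) * f x ≤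
        ∫ x in (c - 1 / 2)..(c + 1 / 2), 32 * f x := by
      apply integral_mono_on hle (hint _ (by fun_prop)) (hint _ (by fun_prop))
      intro x hx
      exact mul_le_mul_of_nonneg_right (by linarith [hsq x hx]) (hf0 x)
    rw [intervalIntegral.integral_const_mul] at hb
    have := mul_le_mul_of_nonneg_left hfi
      (by positivity : 0 ≤ 18 * M ^ 2 * (8 * m ^ 2 + 32 * δ ^ 2))
    linarith
  -- bound of `m`
  have hmle : ∀ r : ℝ, 0 < r → m ≤ 8 * δ + 2 * δ * r + Z / r := by
    intro r hr
    have hya : c - 1 / 2 ≤ y := hy.1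
    have hsub : Icc (c - 1 / 2) y ⊆ Icc (c - 1 / 2) (c + 1 / 2) := Icc_subset_Icc_right hy.2
    have hd : ∫ x in (c - 1 / 2)..y, (-(8 * (x - c)) * f x + η x * f' x) = m := by
      rw [integral_eq_sub_of_hasDerivAt (f := fun x => η x * f x)]
      · have : η (c - 1 / 2) = 0 := by simp only [hη]; ring
        simp only [this, hm]; ring
      · intro x hx
        rw [uIcc_of_le hya] at hx
        have hl : HasDerivAt (fun x : ℝ => x - c) 1 x := (hasDerivAt_id x).sub_const c
        have he : HasDerivAt η (-(8 * (x - c))) x := by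
          have := ((hl.pow 2).const_mul 4).const_sub 1
          refine this.congr_deriv ?_
          norm_num; ring
        exact he.mul (hf x (hsub hx))
      · apply ContinuousOn.intervalIntegrable
        rw [uIcc_of_le hya]
        exact ContinuousOn.mono (by fun_prop) hsub
    set g : ℝ → ℝ := fun x => 4 * f x + r * f x + η x ^ 2 * D x / r with hg
    have hgc : ContinuousOn g (Icc (c - 1 / 2) (c + 1 / 2)) := by
      simp only [hg]; fun_prop
    have hg0 : ∀ x, 0 ≤ g x := fun x => by
      have := hf0 x; have := hD0 x; positivity
    have h1 : m ≤ ∫ x in (c - 1 / 2)..y, g x := by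
      rw [← hd]
      apply integral_mono_on hya
      · apply ContinuousOn.intervalIntegrable
        rw [uIcc_of_le hya]
        exact ContinuousOn.mono (by fun_prop) hsub
      · apply ContinuousOn.intervalIntegrable
        rw [uIcc_of_le hya]
        exact hgc.mono hsub
      · intro x hx
        have hx' := hsub hx
        have a1 : -(8 * (x - c)) * f x ≤ 4 * f x :=
          mul_le_mul_of_nonneg_right (by linarith [hx'.1]) (hf0 x)
        have a2 : η x * f' x ≤ r * f x + η x ^ 2 * D x / r := by
          exact weighted_derivative_le (hf0 x) (hD0 x) (hder x hx') hr
        simp only [hg]; linarith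
    have h2 : ∫ x in (c - 1 / 2)..y, g x ≤ ∫ x in (c - 1 / 2)..(c + 1 / 2), g x := by
      apply integral_mono_interval le_rfl hya hy.2
      · exact Filter.Eventually.of_forall hg0
      · exact hint _ hgc
    have h3 : ∫ x in (c - 1 / 2)..(c + 1 / 2), g x =
        4 * (∫ x in (c - 1 / 2)..(c + 1 / 2), f x) + r * (∫ x in (c - 1 / 2)..(c + 1 / 2), f x)
          + Z / r := by
      simp only [hg]
      rw [integral_add (hint _ (by fun_prop)) (hint _ (by fun_prop)),
        integral_add (hint _ (by fun_prop)) (hint _ (by fun_prop)),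
        intervalIntegral.integral_const_mul, intervalIntegral.integral_const_mul,
        intervalIntegral.integral_div]
    have := mul_le_mul_of_nonneg_left hfi hr.le
    linarith
  have hm2 : m ^ 2 ≤ 256 * δ ^ 2 + 16 * δ * Z := sq_le_of_forall_le_add_div hm0 hδ hZ0 hmle
  have hMd : (M * δ) ^ 2 ≤ 1 / 9216 := by
    have := pow_le_pow_left₀ (mul_nonneg hM hδ.le) hMδ 2
    refine this.trans (by norm_num)
  -- Inserting the bound for m² into the one for Z produces 18·16·16 (Mδ)² Z = 4608 (Mδ)² Z, at most
  -- Z/2 because (Mδ)² ≤ 1/9216. Smallness of Mδ is what closes the loop between m and Z.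
  have hZ2 : Z ≤ 150 * δ := by
    have a1 : M ^ 2 * (δ * m ^ 2) ≤ M ^ 2 * (δ * (256 * δ ^ 2 + 16 * δ * Z)) := by gcongr
    have a2 : (M * δ) ^ 2 * Z ≤ 1 / 9216 * Z := by gcongr
    have a3 : (M * δ) ^ 2 * δ ≤ 1 / 9216 * δ := by gcongr
    nlinarith
  -- 256 + 16·150 = 2656 ≤ 52².
  have hfin : m ≤ 52 * δ := by
    refine le_of_abs_le (abs_le_of_sq_le_sq ?_ (by positivity))
    nlinarith
  have : η c = 1 := by simp [hη]
  have h := hmmax c ⟨by linarith, by linarith⟩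
  rw [this, one_mul] at h
  exact h.trans hfin

/-- At a positive interior maximum z' = 0 and z'' > 0. As `z''` is not assumed continuous, the
contradiction comes from the difference quotient of `z'`: it makes `z'` positive just to the right
of the maximum, so `z` increases there. -/
theorem nonpos_of_le_second_derivative {z z' z'' : ℝ → ℝ} {a b : ℝ} (hab : a ≤ b)
    (hz : ∀ x ∈ Icc a b, HasDerivAt z (z' x) x)
    (hz' : ∀ x ∈ Icc a b, HasDerivAt z' (z'' x) x)
    (hineq : ∀ x ∈ Ioo a b, z x ≤ z'' x) (ha : z a ≤ 0) (hb : z b ≤ 0) :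
    ∀ x ∈ Icc a b, z x ≤ 0 := by
  have hzc : ContinuousOn z (Icc a b) := fun x hx => (hz x hx).continuousAt.continuousWithinAt
  obtain ⟨y, hy, hmax⟩ := isCompact_Icc.exists_isMaxOn (nonempty_Icc.2 hab) hzc
  suffices z y ≤ 0 from fun x hx => (hmax hx).trans this
  by_contra! hpos
  have hyI : y ∈ Ioo a b := by
    refine ⟨lt_of_le_of_ne hy.1 ?_, lt_of_le_of_ne hy.2 ?_⟩
    · rintro rfl; linarith
    · rintro rfl; linarith
  have hloc : IsLocalMax z y := hmax.isLocalMax (Icc_mem_nhds hyI.1 hyI.2)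
  have h0 : z' y = 0 := hloc.hasDerivAt_eq_zero (hz y hy)
  have h2 : 0 < z'' y := hpos.trans_le (hineq y hyI)
  have hs := (hasDerivAt_iff_tendsto_slope.1 (hz' y hy)).eventually (lt_mem_nhds h2)
  have hs' : ∀ᶠ x in nhdsWithin y (Ioi y), 0 < slope z' y x :=
    hs.filter_mono (nhdsWithin_mono _ fun x hx => ne_of_gt hx)
  have hs'' : ∀ᶠ x in nhdsWithin y (Ioi y), x < b :=
    (eventually_lt_nhds hyI.2).filter_mono nhdsWithin_le_nhds
  obtain ⟨c, hc, hcs⟩ := mem_nhdsGT_iff_exists_Ioc_subset.1 (hs'.and hs'')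
  have hyc : y < c := hc
  have hcb : c < b := (hcs ⟨hyc, le_rfl⟩).2
  have hsub : Icc y c ⊆ Icc a b := Icc_subset_Icc hy.1 hcb.le
  have hmono : StrictMonoOn z (Icc y c) := by
    apply strictMonoOn_of_deriv_pos (convex_Icc y c) (hzc.mono hsub)
    intro x hx
    rw [interior_Icc] at hx
    rw [(hz x (hsub (Ioo_subset_Icc_self hx))).deriv]
    have h3 : 0 < slope z' y x := (hcs ⟨hx.1, hx.2.le⟩).1
    rw [slope_def_field, h0, sub_zero] at h3
    exact (div_pos_iff_of_pos_right (sub_pos.2 hx.1)).1 h3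
  have h4 := hmono (left_mem_Icc.2 hyc.le) (right_mem_Icc.2 hyc.le) hyc
  have h5 : z c ≤ z y := hmax (hsub (right_mem_Icc.2 hyc.le))
  linarith

theorem integral_exp_neg_abs_sub {T : ℝ → ℝ} {a s : ℝ} (hs : s ∈ Icc (-a) a)
    (hT : ContinuousOn T (Icc (-a) a)) :
    ∫ q in (-a)..a, Real.exp (-|s - q|) * T q =
      Real.exp (-s) * (∫ q in (-a)..s, Real.exp q * T q)
        + Real.exp s * (∫ q in s..a, Real.exp (-q) * T q) := by
  have hc : ContinuousOn (fun q => Real.exp (-|s - q|) * T q) (Icc (-a) a) := by fun_prop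
  rw [← integral_add_adjacent_intervals (b := s), ← intervalIntegral.integral_const_mul,
    ← intervalIntegral.integral_const_mul]
  · congr 1
    · apply integral_congr
      intro q hq
      rw [uIcc_of_le hs.1] at hq
      simp only
      rw [abs_of_nonneg (sub_nonneg.2 hq.2), ← mul_assoc, ← Real.exp_add]
      ring_nf
    · apply integral_congr
      intro q hq
      rw [uIcc_of_le hs.2] at hq
      simp only
      rw [abs_of_nonpos (sub_nonpos.2 hq.1), ← mul_assoc, ← Real.exp_add]
      ring_nf
  · apply ContinuousOn.intervalIntegrable
    rw [uIcc_of_le hs.1]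
    exact hc.mono (Icc_subset_Icc_right hs.2)
  · apply ContinuousOn.intervalIntegrable
    rw [uIcc_of_le hs.2]
    exact hc.mono (Icc_subset_Icc_left hs.1)

theorem hasDerivAt_integral_of_continuousOn_Ioo {g : ℝ → ℝ} {b x₀ s : ℝ}
    (hg : ContinuousOn g (Ioo (-b) b)) (hx₀ : x₀ ∈ Ioo (-b) b) (hs : s ∈ Ioo (-b) b) :
    HasDerivAt (fun x => ∫ q in x₀..x, g q) (g s) s := by
  have hnhds : Ioo (-b) b ∈ nhds s := Ioo_mem_nhds hs.1 hs.2
  apply integral_hasDerivAt_right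
  · apply ContinuousOn.intervalIntegrable
    exact hg.mono (ordConnected_Ioo.uIcc_subset hx₀ hs)
  · exact ⟨_, hnhds, hg.aestronglyMeasurable measurableSet_Ioo⟩
  · exact hg.continuousAt hnhds

/-- Comparison with the supersolution k cosh + I, where I is the exponential kernel integral of T
and k cosh a = m takes care of the boundary values. Splitting I at s as e^{-s}A(s) + e^{s}B(s) makes
it visibly twice differentiable. Continuity of `T` on the larger interval lets the primitives be
differentiated at the endpoints ±a too. -/
theorem le_cosh_add_integral_of_le_second_derivative {f f' f'' T : ℝ → ℝ} {a b m : ℝ}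
    (ha : 0 ≤ a) (hab : a < b)
    (hf : ∀ x ∈ Icc (-a) a, HasDerivAt f (f' x) x)
    (hf' : ∀ x ∈ Icc (-a) a, HasDerivAt f' (f'' x) x)
    (hT : ContinuousOn T (Ioo (-b) b)) (hT0 : ∀ x, 0 ≤ T x)
    (hineq : ∀ x ∈ Ioo (-a) a, f x - 2 * T x ≤ f'' x) (hm : 0 ≤ m)
    (hfa : f (-a) ≤ m) (hfb : f a ≤ m) :
    ∀ s ∈ Icc (-a) a, f s ≤ m * (Real.cosh s / Real.cosh a)
      + ∫ q in (-a)..a, Real.exp (-|s - q|) * T q := by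
  have hsub : Icc (-a) a ⊆ Ioo (-b) b := Icc_subset_Ioo (neg_lt_neg hab) hab
  have hmem : -a ∈ Icc (-a) a := ⟨le_rfl, by linarith⟩
  have hmem' : a ∈ Icc (-a) a := ⟨by linarith, le_rfl⟩
  set A : ℝ → ℝ := fun s => ∫ q in (-a)..s, Real.exp q * T q with hA
  set B : ℝ → ℝ := fun s => ∫ q in s..a, Real.exp (-q) * T q with hB
  have hAd : ∀ x ∈ Icc (-a) a, HasDerivAt A (Real.exp x * T x) x := fun x hx =>
    hasDerivAt_integral_of_continuousOn_Ioo (b := b) (g := fun q => Real.exp q * T q)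
      (by fun_prop) (hsub hmem) (hsub hx)
  have hBd : ∀ x ∈ Icc (-a) a, HasDerivAt B (-(Real.exp (-x) * T x)) x := fun x hx => by
    have := hasDerivAt_integral_of_continuousOn_Ioo (b := b) (g := fun q => Real.exp (-q) * T q)
      (by fun_prop) (hsub hmem') (hsub hx)
    refine this.neg.congr_of_eventuallyEq (Filter.Eventually.of_forall fun y => ?_)
    simp only [hB, Pi.neg_apply]
    rw [integral_symm]
  have he : ∀ x : ℝ, HasDerivAt (fun x => Real.exp (-x)) (-Real.exp (-x)) x := fun x => by
    simpa using (hasDerivAt_neg x).exp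
  set k := m / Real.cosh a with hk
  have hcosh := Real.cosh_pos a
  have hk0 : 0 ≤ k := by positivity
  have hint0 : ∀ s, 0 ≤ ∫ q in (-a)..a, Real.exp (-|s - q|) * T q := fun s =>
    integral_nonneg (by linarith) fun q _ => mul_nonneg (Real.exp_pos _).le (hT0 q)
  have hform : ∀ s ∈ Icc (-a) a, ∫ q in (-a)..a, Real.exp (-|s - q|) * T q =
      Real.exp (-s) * A s + Real.exp s * B s := fun s hs =>
    integral_exp_neg_abs_sub hs (hT.mono hsub)
  have key := nonpos_of_le_second_derivative (a := -a) (b := a)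
    (z := fun x => f x - (k * Real.cosh x + (Real.exp (-x) * A x + Real.exp x * B x)))
    (z' := fun x => f' x - (k * Real.sinh x + (-Real.exp (-x) * A x + Real.exp x * B x)))
    (z'' := fun x => f'' x - (k * Real.cosh x
      + (Real.exp (-x) * A x + Real.exp x * B x - 2 * T x)))
    (by linarith)
    (fun x hx => by
      refine ((hf x hx).sub (((Real.hasDerivAt_cosh x).const_mul k).add
        (((he x).mul (hAd x hx)).add ((Real.hasDerivAt_exp x).mul (hBd x hx))))).congr_deriv ?_
      ring)
    (fun x hx => by
      refine ((hf' x hx).sub (((Real.hasDerivAt_sinh x).const_mul k).add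
        ((((he x).neg).mul (hAd x hx)).add ((Real.hasDerivAt_exp x).mul (hBd x hx))))).congr_deriv ?_
      -- The derivatives of A and B cancel in the first derivative of I and add up to -2T in the
      -- second.
      have h1 : Real.exp (-x) * Real.exp x = 1 := by rw [← Real.exp_add]; simp
      simp only [Pi.neg_apply]
      linear_combination (2 * T x) * h1)
    (fun x hx => by
      have := hineq x hx
      linarith)
    (by
      have := hint0 (-a)
      rw [hform _ hmem] at this
      have h1 : k * Real.cosh (-a) = m := by rw [Real.cosh_neg, hk]; field_simp
      linarith)
    (by
      have := hint0 a
      rw [hform _ hmem'] at this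
      have h1 : k * Real.cosh a = m := by rw [hk]; field_simp
      linarith)
  intro s hs
  have := key s hs
  rw [hform s hs]
  have h1 : m * (Real.cosh s / Real.cosh a) = k * Real.cosh s := by rw [hk]; ring
  linarith

/-! ### Functions on the circle -/

/-- **Wirtinger's inequality** for complex-valued functions. -/
theorem wirtinger_complex {f f' : ℝ → ℂ} (hf : ∀ x, HasDerivAt f (f' x) x) (hf' : Continuous f')
    (hper : f (2 * Real.pi) = f 0) (hmean : ∫ x in (0 : ℝ)..(2 * Real.pi), f x = 0) :
    ∫ x in (0 : ℝ)..(2 * Real.pi), ‖f x‖ ^ 2 ≤ ∫ x in (0 : ℝ)..(2 * Real.pi), ‖f' x‖ ^ 2 := by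
  have hpi := Real.two_pi_pos
  have hfc : Continuous f := continuous_iff_continuousAt.2 fun x => (hf x).continuousAt
  have hL : ∀ g : ℝ → ℂ, Continuous g → MemLp g 2 (volume.restrict (Ioc 0 (2 * Real.pi))) := by
    intro g hg
    refine MemLp.mono_measure (Measure.restrict_mono Ioc_subset_Icc_self le_rfl) ?_
    obtain ⟨C, hC⟩ := isCompact_Icc.exists_bound_of_continuousOn (hg.continuousOn
      (s := Icc 0 (2 * Real.pi)))
    refine MemLp.of_bound hg.aestronglyMeasurable C ?_
    exact (ae_restrict_iff' measurableSet_Icc).2 (Filter.Eventually.of_forall hC)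
  have h1 := hasSum_sq_fourierCoeffOn hpi (hL f hfc)
  have h2 := hasSum_sq_fourierCoeffOn hpi (hL f' hf')
  have hle := hasSum_le (fun i => ?_) h1 h2
  · rw [smul_eq_mul, smul_eq_mul] at hle
    exact le_of_mul_le_mul_left hle (by simpa using hpi)
  · rcases eq_or_ne i 0 with rfl | hi
    · have : fourierCoeffOn hpi f 0 = 0 := by
        rw [fourierCoeffOn_eq_integral]
        simp [hmean]
      rw [this]; simp
    -- Periodicity kills the boundary term, so the i-th coefficient of f is that of f' divided by i
    -- up to a unit factor. The mode i = 0 is handled by the zero mean, and Parseval sums the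
    -- comparison.
    · have hc := fourierCoeffOn_of_hasDerivAt hpi hi (fun x _ => hf x)
        (hf'.intervalIntegrable _ _)
      rw [hper, sub_self, mul_zero, zero_sub] at hc
      rw [hc]
      apply pow_le_pow_left₀ (norm_nonneg _)
      have hi1 : (1 : ℝ) ≤ |(i : ℝ)| := by exact_mod_cast Int.one_le_abs hi
      simp only [norm_mul, norm_div, norm_neg, norm_one, Complex.norm_I, Complex.norm_intCast,
        Complex.ofReal_zero, sub_zero, Complex.ofReal_mul, Complex.norm_real, mul_one,
        Complex.ofReal_ofNat, Complex.norm_ofNat, Real.norm_eq_abs, abs_of_pos Real.pi_pos]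
      have h3 : 0 < 2 * Real.pi * |(i : ℝ)| := by positivity
      rw [one_div, inv_mul_le_iff₀ h3]
      have := norm_nonneg (fourierCoeffOn hpi f' i)
      nlinarith [mul_nonneg hpi.le this]

/-- **Wirtinger's inequality** for maps into Euclidean space. -/
theorem wirtinger {k : ℕ} {f f' : ℝ → EuclideanSpace ℝ (Fin k)}
    (hf : ∀ x, HasDerivAt f (f' x) x) (hf' : Continuous f')
    (hper : f (2 * Real.pi) = f 0) (hmean : ∫ x in (0 : ℝ)..(2 * Real.pi), f x = 0) :
    ∫ x in (0 : ℝ)..(2 * Real.pi), ‖f x‖ ^ 2 ≤ ∫ x in (0 : ℝ)..(2 * Real.pi), ‖f' x‖ ^ 2 := by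
  have hfc : Continuous f := continuous_iff_continuousAt.2 fun x => (hf x).continuousAt
  simp only [EuclideanSpace.norm_sq_eq]
  rw [integral_finsetSum (fun i _ => (Continuous.intervalIntegrable (by fun_prop) _ _)),
    integral_finsetSum (fun i _ => (Continuous.intervalIntegrable (by fun_prop) _ _))]
  refine Finset.sum_le_sum fun i _ => ?_
  have hi : ∀ x, HasDerivAt (fun x => ((f x i : ℝ) : ℂ)) ((f' x i : ℝ) : ℂ) x := fun x => by
    apply HasDerivAt.ofReal_comp
    exact (EuclideanSpace.proj (𝕜 := ℝ) i).hasFDerivAt.comp_hasDerivAt x (hf x)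
  have hm : ∫ x in (0 : ℝ)..(2 * Real.pi), f x i = 0 := by
    have := (EuclideanSpace.proj (𝕜 := ℝ) i).intervalIntegral_comp_comm
      (hfc.intervalIntegrable (μ := volume) 0 (2 * Real.pi))
    rw [hmean, map_zero] at this
    exact this
  have := wirtinger_complex hi (by fun_prop) (by rw [hper])
    (by rw [intervalIntegral.integral_ofReal, hm]; simp)
  simpa only [Complex.norm_real] using this

/-- Cauchy–Schwarz, from the discriminant of the nonnegative quadratic t ↦ ∫(t‖f‖ + ‖g‖)². -/
theorem integral_norm_mul_norm_sq_le {E F : Type*} [NormedAddCommGroup E] [NormedAddCommGroup F]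
    {f : ℝ → E} {g : ℝ → F} {a b : ℝ} (hab : a ≤ b)
    (hf : Continuous f) (hg : Continuous g) :
    (∫ x in a..b, ‖f x‖ * ‖g x‖) ^ 2 ≤ (∫ x in a..b, ‖f x‖ ^ 2) * ∫ x in a..b, ‖g x‖ ^ 2 := by
  have h := discrim_le_zero (a := ∫ x in a..b, ‖f x‖ ^ 2) (b := 2 * ∫ x in a..b, ‖f x‖ * ‖g x‖)
    (c := ∫ x in a..b, ‖g x‖ ^ 2) (fun t => by
      have h0 : 0 ≤ ∫ x in a..b, (t * t * ‖f x‖ ^ 2 + 2 * t * (‖f x‖ * ‖g x‖) + ‖g x‖ ^ 2) :=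
        integral_nonneg hab fun x _ => by nlinarith [sq_nonneg (t * ‖f x‖ + ‖g x‖)]
      rw [integral_add (Continuous.intervalIntegrable (by fun_prop) _ _)
          (Continuous.intervalIntegrable (by fun_prop) _ _),
        integral_add (Continuous.intervalIntegrable (by fun_prop) _ _)
          (Continuous.intervalIntegrable (by fun_prop) _ _),
        intervalIntegral.integral_const_mul, intervalIntegral.integral_const_mul] at h0
      linarith)
  rw [discrim] at h
  linarith

theorem integral_inner_sq_le {E : Type*} [NormedAddCommGroup E] [InnerProductSpace ℝ E] {f g : ℝ → E} {a b : ℝ} (hab : a ≤ b)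
    (hf : Continuous f) (hg : Continuous g) :
    (∫ x in a..b, inner ℝ (f x) (g x)) ^ 2 ≤
      (∫ x in a..b, ‖f x‖ ^ 2) * ∫ x in a..b, ‖g x‖ ^ 2 := by
  refine le_trans ?_ (integral_norm_mul_norm_sq_le hab hf hg)
  rw [sq_le_sq]
  calc |∫ x in a..b, inner ℝ (f x) (g x)| ≤ ∫ x in a..b, |inner ℝ (f x) (g x)| :=
        abs_integral_le_integral_abs hab
    _ ≤ ∫ x in a..b, ‖f x‖ * ‖g x‖ := by
        apply integral_mono_on hab (Continuous.intervalIntegrable (by fun_prop) _ _)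
          (Continuous.intervalIntegrable (by fun_prop) _ _)
        exact fun x _ => abs_real_inner_le_norm _ _
    _ ≤ _ := le_abs_self _

theorem norm_sq_sub_norm_sq_le {E : Type*} [NormedAddCommGroup E] [InnerProductSpace ℝ E]
    {f f' : ℝ → E} (hf : ∀ x, HasDerivAt f (f' x) x) (hf' : Continuous f') {a b x y : ℝ}
    (hx : x ∈ Icc a b) (hy : y ∈ Icc a b) :
    ‖f x‖ ^ 2 - ‖f y‖ ^ 2 ≤ 2 * ∫ t in a..b, ‖f t‖ * ‖f' t‖ := by
  have hfc : Continuous f := continuous_iff_continuousAt.2 fun x => (hf x).continuousAt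
  have hab : a ≤ b := hx.1.trans hx.2
  have h1 : ∫ t in y..x, 2 * inner ℝ (f t) (f' t) = ‖f x‖ ^ 2 - ‖f y‖ ^ 2 :=
    integral_eq_sub_of_hasDerivAt (fun t _ => (hf t).norm_sq)
      (Continuous.intervalIntegrable (by fun_prop) _ _)
  rw [← h1, ← intervalIntegral.integral_const_mul]
  refine (le_abs_self _).trans ?_
  rw [← Real.norm_eq_abs]
  refine (norm_integral_le_integral_norm_uIoc).trans ?_
  rw [integral_of_le hab]
  have hI : IntegrableOn (fun t => 2 * (‖f t‖ * ‖f' t‖)) (Ioc a b) :=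
    (Continuous.integrableOn_Icc (by fun_prop)).mono_set Ioc_subset_Icc_self
  have hsub : uIoc y x ⊆ Ioc a b := by
    rw [uIoc]
    exact Ioc_subset_Ioc (le_min hy.1 hx.1) (max_le hy.2 hx.2)
  refine le_trans ?_ (setIntegral_mono_set hI (Filter.Eventually.of_forall fun t => by positivity)
    (Filter.Eventually.of_forall hsub))
  refine setIntegral_mono ((Continuous.integrableOn_Icc (by fun_prop)).mono_set
    (hsub.trans Ioc_subset_Icc_self)) (hI.mono_set hsub) fun t => ?_
  rw [Real.norm_eq_abs, abs_mul, abs_two]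
  exact mul_le_mul_of_nonneg_left (abs_real_inner_le_norm _ _) zero_le_two

/-- Average ‖f(x)‖² ≤ ‖f(y)‖² + 2∫‖f‖‖f'‖ over y. Cauchy–Schwarz bounds the last integral by the
square root, and Wirtinger's inequality bounds the average of ‖f‖² by it as well, whence 1 + 2 = 3.
-/
theorem norm_sq_le_of_mean_zero {k : ℕ} {f f' : ℝ → EuclideanSpace ℝ (Fin k)}
    (hf : ∀ x, HasDerivAt f (f' x) x) (hf' : Continuous f')
    (hper : f (2 * Real.pi) = f 0) (hmean : ∫ x in (0 : ℝ)..(2 * Real.pi), f x = 0)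
    {x : ℝ} (hx : x ∈ Icc 0 (2 * Real.pi)) :
    ‖f x‖ ^ 2 ≤ 3 * √((∫ x in (0 : ℝ)..(2 * Real.pi), ‖f x‖ ^ 2) *
      ∫ x in (0 : ℝ)..(2 * Real.pi), ‖f' x‖ ^ 2) := by
  have hpi := Real.two_pi_pos
  have hfc : Continuous f := continuous_iff_continuousAt.2 fun x => (hf x).continuousAt
  have hW := wirtinger hf hf' hper hmean
  have hCS := Real.le_sqrt_of_sq_le (integral_norm_mul_norm_sq_le hpi.le hfc hf')
  set X := ∫ t in (0 : ℝ)..(2 * Real.pi), ‖f t‖ * ‖f' t‖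
  set A := ∫ x in (0 : ℝ)..(2 * Real.pi), ‖f x‖ ^ 2 with hA
  set B := ∫ x in (0 : ℝ)..(2 * Real.pi), ‖f' x‖ ^ 2
  have hA0 : 0 ≤ A := integral_nonneg hpi.le fun _ _ => by positivity
  have hAR : A ≤ √(A * B) := Real.le_sqrt_of_sq_le (by nlinarith)
  have havg : ∫ y in (0 : ℝ)..(2 * Real.pi), (‖f x‖ ^ 2 - 2 * X) ≤ A := by
    apply integral_mono_on hpi.le (by simp) (Continuous.intervalIntegrable (by fun_prop) _ _)
    intro y hy
    linarith [norm_sq_sub_norm_sq_le hf hf' hx hy]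
  rw [intervalIntegral.integral_const, smul_eq_mul, sub_zero] at havg
  have h1 : A ≤ 2 * Real.pi * √(A * B) := by
    nlinarith [Real.pi_gt_three, Real.sqrt_nonneg (A * B)]
  have h2 := le_of_mul_le_mul_left (havg.trans h1) hpi
  linarith

/-! ### Integrals over circles depending on a parameter -/

/-- Supplies the constant dominating function for continuity and differentiation under the circle
integral. -/
theorem exists_bound_near {F : Type*} [NormedAddCommGroup F] {g : ℝ → ℝ → F} {a b s : ℝ}
    (hg : ContinuousOn (Function.uncurry g) (Ioo a b ×ˢ univ)) (hs : s ∈ Ioo a b) (c d : ℝ) :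
    ∃ V ∈ nhds s, V ⊆ Ioo a b ∧ ∃ C, ∀ x ∈ V, ∀ θ ∈ Icc c d, ‖g x θ‖ ≤ C := by
  obtain ⟨l, u, hlu, hV, hsub⟩ := exists_Icc_mem_subset_of_mem_nhds (Ioo_mem_nhds hs.1 hs.2)
  refine ⟨Icc l u, hV, hsub, ?_⟩
  obtain ⟨C, hC⟩ := (isCompact_Icc.prod isCompact_Icc (s := Icc l u)
    (t := Icc c d)).exists_bound_of_continuousOn (hg.mono (prod_mono hsub (subset_univ _)))
  exact ⟨C, fun x hx θ hθ => hC (x, θ) ⟨hx, hθ⟩⟩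

theorem continuous_slice {F : Type*} [TopologicalSpace F] {g : ℝ → ℝ → F} {a b s : ℝ}
    (hg : ContinuousOn (Function.uncurry g) (Ioo a b ×ˢ univ)) (hs : s ∈ Ioo a b) :
    Continuous (g s) := by
  rw [← continuousOn_univ]
  exact hg.comp (f := fun θ => (s, θ)) (by fun_prop) fun θ _ => ⟨hs, mem_univ _⟩

theorem continuousAt_slice {F : Type*} [TopologicalSpace F] {g : ℝ → ℝ → F} {a b s : ℝ}
    (hg : ContinuousOn (Function.uncurry g) (Ioo a b ×ˢ univ)) (hs : s ∈ Ioo a b) (θ : ℝ) :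
    ContinuousAt (fun x => g x θ) s := by
  have : ContinuousAt (Function.uncurry g) (s, θ) :=
    hg.continuousAt ((isOpen_Ioo.prod isOpen_univ).mem_nhds ⟨hs, mem_univ _⟩)
  exact ContinuousAt.comp (f := fun x => (x, θ)) this (by fun_prop)

theorem continuousOn_integral_slice {g : ℝ → ℝ → ℝ} {a b c d : ℝ} (hcd : c ≤ d)
    (hg : ContinuousOn (Function.uncurry g) (Ioo a b ×ˢ univ)) :
    ContinuousOn (fun s => ∫ θ in c..d, g s θ) (Ioo a b) := by
  intro s hs
  apply ContinuousAt.continuousWithinAt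
  obtain ⟨V, hV, hVs, C, hC⟩ := exists_bound_near hg hs c d
  apply continuousAt_of_dominated_interval (bound := fun _ => C)
  · filter_upwards [hV] with x hx
    exact (continuous_slice hg (hVs hx)).aestronglyMeasurable
  · filter_upwards [hV] with x hx
    refine Filter.Eventually.of_forall fun θ hθ => hC x hx θ ?_
    rw [uIoc_of_le hcd] at hθ
    exact Ioc_subset_Icc_self hθ
  · simp
  · exact Filter.Eventually.of_forall fun θ _ => continuousAt_slice hg hs θ

theorem hasDerivAt_integral_slice {g g' : ℝ → ℝ → ℝ} {a b c d : ℝ} (hcd : c ≤ d)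
    (hg : ContinuousOn (Function.uncurry g) (Ioo a b ×ˢ univ))
    (hg' : ContinuousOn (Function.uncurry g') (Ioo a b ×ˢ univ))
    (hd : ∀ s ∈ Ioo a b, ∀ θ, HasDerivAt (fun x => g x θ) (g' s θ) s) {s : ℝ} (hs : s ∈ Ioo a b) :
    HasDerivAt (fun s => ∫ θ in c..d, g s θ) (∫ θ in c..d, g' s θ) s := by
  obtain ⟨V, hV, hVs, C, hC⟩ := exists_bound_near hg' hs c d
  refine (intervalIntegral.hasDerivAt_integral_of_dominated_loc_of_deriv_le (bound := fun _ => C) hV ?_ ?_ ?_ ?_ ?_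
    ?_).2
  · filter_upwards [hV] with x hx
    exact (continuous_slice hg (hVs hx)).aestronglyMeasurable
  · exact (continuous_slice hg hs).intervalIntegrable _ _
  · exact (continuous_slice hg' hs).aestronglyMeasurable
  · refine Filter.Eventually.of_forall fun θ hθ x hx => hC x hx θ ?_
    rw [uIoc_of_le hcd] at hθ
    exact Ioc_subset_Icc_self hθ
  · simp
  · exact Filter.Eventually.of_forall fun θ _ x hx => hd x (hVs hx) θ

/-! ### Partial derivatives -/

section Partial

variable {E : Type*} [NormedAddCommGroup E] [NormedSpace ℝ E] {f : ℝ → ℝ → E} {a b : ℝ}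

theorem isOpen_strip : IsOpen (Ioo a b ×ˢ (univ : Set ℝ)) := isOpen_Ioo.prod isOpen_univ

theorem hasDerivAt_fst (hf : ContDiffOn ℝ ∞ (Function.uncurry f) (Ioo a b ×ˢ univ)) {s : ℝ}
    (hs : s ∈ Ioo a b) (θ : ℝ) :
    HasDerivAt (fun x => f x θ) (fderiv ℝ (Function.uncurry f) (s, θ) (1, 0)) s := by
  have h : DifferentiableAt ℝ (Function.uncurry f) (s, θ) :=
    (hf.contDiffAt (isOpen_strip.mem_nhds ⟨hs, mem_univ _⟩)).differentiableAt (by simp)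
  exact h.hasFDerivAt.comp_hasDerivAt (f := fun x => (x, θ)) s
    ((hasDerivAt_id s).prodMk (hasDerivAt_const s θ))

theorem hasDerivAt_snd (hf : ContDiffOn ℝ ∞ (Function.uncurry f) (Ioo a b ×ˢ univ)) {s : ℝ}
    (hs : s ∈ Ioo a b) (θ : ℝ) :
    HasDerivAt (fun x => f s x) (fderiv ℝ (Function.uncurry f) (s, θ) (0, 1)) θ := by
  have h : DifferentiableAt ℝ (Function.uncurry f) (s, θ) :=
    (hf.contDiffAt (isOpen_strip.mem_nhds ⟨hs, mem_univ _⟩)).differentiableAt (by simp)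
  exact h.hasFDerivAt.comp_hasDerivAt (f := fun x => (s, x)) θ
    ((hasDerivAt_const θ s).prodMk (hasDerivAt_id θ))

theorem hasDerivAt_derivS (hf : ContDiffOn ℝ ∞ (Function.uncurry f) (Ioo a b ×ˢ univ)) {s : ℝ}
    (hs : s ∈ Ioo a b) (θ : ℝ) : HasDerivAt (fun x => f x θ) (derivS f s θ) s :=
  (hasDerivAt_fst hf hs θ).differentiableAt.hasDerivAt

theorem hasDerivAt_derivTheta (hf : ContDiffOn ℝ ∞ (Function.uncurry f) (Ioo a b ×ˢ univ)) {s : ℝ}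
    (hs : s ∈ Ioo a b) (θ : ℝ) : HasDerivAt (fun x => f s x) (derivTheta f s θ) θ :=
  (hasDerivAt_snd hf hs θ).differentiableAt.hasDerivAt

theorem contDiffOn_fderiv_apply
    (hf : ContDiffOn ℝ ∞ (Function.uncurry f) (Ioo a b ×ˢ univ)) (v : ℝ × ℝ) :
    ContDiffOn ℝ ∞ (fun x => fderiv ℝ (Function.uncurry f) x v) (Ioo a b ×ˢ univ) :=
  (hf.fderiv_of_isOpen isOpen_strip (by simp)).clm_apply contDiffOn_const

theorem contDiffOn_derivS (hf : ContDiffOn ℝ ∞ (Function.uncurry f) (Ioo a b ×ˢ univ)) :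
    ContDiffOn ℝ ∞ (Function.uncurry (derivS f)) (Ioo a b ×ˢ univ) :=
  (contDiffOn_fderiv_apply hf (1, 0)).congr fun x hx => (hasDerivAt_fst hf hx.1 x.2).deriv

theorem contDiffOn_derivTheta (hf : ContDiffOn ℝ ∞ (Function.uncurry f) (Ioo a b ×ˢ univ)) :
    ContDiffOn ℝ ∞ (Function.uncurry (derivTheta f)) (Ioo a b ×ˢ univ) :=
  (contDiffOn_fderiv_apply hf (0, 1)).congr fun x hx => (hasDerivAt_snd hf hx.1 x.2).deriv

theorem fderiv_uncurry_derivS (hf : ContDiffOn ℝ ∞ (Function.uncurry f) (Ioo a b ×ˢ univ)) {s : ℝ}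
    (hs : s ∈ Ioo a b) (θ : ℝ) (v : ℝ × ℝ) :
    fderiv ℝ (Function.uncurry (derivS f)) (s, θ) v =
      fderiv ℝ (fderiv ℝ (Function.uncurry f)) (s, θ) v (1, 0) := by
  have hm := isOpen_strip.mem_nhds (⟨hs, mem_univ _⟩ : (s, θ) ∈ Ioo a b ×ˢ (univ : Set ℝ))
  have h : Function.uncurry (derivS f) =ᶠ[nhds (s, θ)]
      fun x => fderiv ℝ (Function.uncurry f) x (1, 0) :=
    Filter.eventuallyEq_of_mem hm fun x hx => (hasDerivAt_fst hf hx.1 x.2).deriv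
  have hd : DifferentiableAt ℝ (fderiv ℝ (Function.uncurry f)) (s, θ) :=
    ((hf.fderiv_of_isOpen (m := ∞) isOpen_strip (by simp)).contDiffAt hm).differentiableAt (by simp)
  rw [h.fderiv_eq, fderiv_clm_apply hd (by fun_prop)]
  simp

theorem fderiv_uncurry_derivTheta (hf : ContDiffOn ℝ ∞ (Function.uncurry f) (Ioo a b ×ˢ univ))
    {s : ℝ} (hs : s ∈ Ioo a b) (θ : ℝ) (v : ℝ × ℝ) :
    fderiv ℝ (Function.uncurry (derivTheta f)) (s, θ) v =
      fderiv ℝ (fderiv ℝ (Function.uncurry f)) (s, θ) v (0, 1) := by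
  have hm := isOpen_strip.mem_nhds (⟨hs, mem_univ _⟩ : (s, θ) ∈ Ioo a b ×ˢ (univ : Set ℝ))
  have h : Function.uncurry (derivTheta f) =ᶠ[nhds (s, θ)]
      fun x => fderiv ℝ (Function.uncurry f) x (0, 1) :=
    Filter.eventuallyEq_of_mem hm fun x hx => (hasDerivAt_snd hf hx.1 x.2).deriv
  have hd : DifferentiableAt ℝ (fderiv ℝ (Function.uncurry f)) (s, θ) :=
    ((hf.fderiv_of_isOpen (m := ∞) isOpen_strip (by simp)).contDiffAt hm).differentiableAt (by simp)
  rw [h.fderiv_eq, fderiv_clm_apply hd (by fun_prop)]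
  simp

theorem derivS_derivTheta_comm (hf : ContDiffOn ℝ ∞ (Function.uncurry f) (Ioo a b ×ˢ univ)) {s : ℝ}
    (hs : s ∈ Ioo a b) (θ : ℝ) :
    derivS (derivTheta f) s θ = derivTheta (derivS f) s θ := by
  have h1 : derivS (derivTheta f) s θ = _ := (hasDerivAt_fst (contDiffOn_derivTheta hf) hs θ).deriv
  have h2 : derivTheta (derivS f) s θ = _ := (hasDerivAt_snd (contDiffOn_derivS hf) hs θ).deriv
  rw [h1, h2, fderiv_uncurry_derivTheta hf hs, fderiv_uncurry_derivS hf hs]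
  have hm := isOpen_strip.mem_nhds (⟨hs, mem_univ _⟩ : (s, θ) ∈ Ioo a b ×ˢ (univ : Set ℝ))
  exact ((hf.contDiffAt hm).isSymmSndFDerivAt
    (by simpa using WithTop.coe_le_coe.2 (le_top : (2 : ℕ∞) ≤ ⊤))).eq _ _

end Partial

/-! ### Circle integrals of maps with almost orthogonal Laplacian defect -/

/-- `∫_{{s} × S¹} |f|²`, as a real number. -/
def circleSq {E : Type*} [NormedAddCommGroup E] (f : ℝ → ℝ → E) (s : ℝ) : ℝ :=
  ∫ θ in (0 : ℝ)..(2 * Real.pi), ‖f s θ‖ ^ 2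

theorem circleSq_nonneg {E : Type*} [NormedAddCommGroup E] (f : ℝ → ℝ → E) (s : ℝ) :
    0 ≤ circleSq f s :=
  integral_nonneg Real.two_pi_pos.le fun _ _ => by positivity

theorem continuousOn_circleSq {E : Type*} [NormedAddCommGroup E] {f : ℝ → ℝ → E} {a b : ℝ}
    (hf : ContinuousOn (Function.uncurry f) (Ioo a b ×ˢ univ)) :
    ContinuousOn (circleSq f) (Ioo a b) :=
  continuousOn_integral_slice (g := fun s θ => ‖f s θ‖ ^ 2) Real.two_pi_pos.le (hf.norm.pow 2)

section Strip

variable {k : ℕ} {w : ℝ → ℝ → EuclideanSpace ℝ (Fin k)} {a b : ℝ}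

theorem hasDerivAt_circleSq {E : Type*} [NormedAddCommGroup E] [InnerProductSpace ℝ E]
    {f : ℝ → ℝ → E} (hf : ContDiffOn ℝ ∞ (Function.uncurry f) (Ioo a b ×ˢ univ))
    {s : ℝ} (hs : s ∈ Ioo a b) :
    HasDerivAt (circleSq f)
      (∫ θ in (0 : ℝ)..(2 * Real.pi), 2 * inner ℝ (f s θ) (derivS f s θ)) s := by
  apply hasDerivAt_integral_slice (a := a) (b := b) (g := fun s θ => ‖f s θ‖ ^ 2)
    (g' := fun s θ => 2 * inner ℝ (f s θ) (derivS f s θ)) Real.two_pi_pos.le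
    (by have := hf.continuousOn; simp only [Function.uncurry_def] at this ⊢; fun_prop) _ _ hs
  · exact continuousOn_const.mul (hf.continuousOn.inner (𝕜 := ℝ) (contDiffOn_derivS hf).continuousOn)
  · exact fun s hs θ => (hasDerivAt_derivS hf hs θ).norm_sq

theorem derivTheta_periodic (hper : ∀ s θ, w s (θ + 2 * Real.pi) = w s θ) (s θ : ℝ) :
    derivTheta w s (θ + 2 * Real.pi) = derivTheta w s θ := by
  unfold derivTheta
  rw [← deriv_comp_add_const]
  simp only [hper]

theorem derivS_periodic (hper : ∀ s θ, w s (θ + 2 * Real.pi) = w s θ) (s θ : ℝ) :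
    derivS w s (θ + 2 * Real.pi) = derivS w s θ := by
  unfold derivS
  simp only [hper]

theorem integral_derivTheta_eq_zero
    (hw : ContDiffOn ℝ ∞ (Function.uncurry w) (Ioo a b ×ˢ univ))
    (hper : ∀ s θ, w s (θ + 2 * Real.pi) = w s θ) {s : ℝ} (hs : s ∈ Ioo a b) :
    ∫ θ in (0 : ℝ)..(2 * Real.pi), derivTheta w s θ = 0 := by
  rw [integral_eq_sub_of_hasDerivAt (fun θ _ => hasDerivAt_derivTheta hw hs θ)
    ((continuous_slice (contDiffOn_derivTheta hw).continuousOn hs).intervalIntegrable _ _)]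
  have := hper s 0
  rw [zero_add] at this
  rw [this, sub_self]

theorem circleSq_derivTheta_le
    (hw : ContDiffOn ℝ ∞ (Function.uncurry w) (Ioo a b ×ˢ univ))
    (hper : ∀ s θ, w s (θ + 2 * Real.pi) = w s θ) {s : ℝ} (hs : s ∈ Ioo a b) :
    circleSq (derivTheta w) s ≤ circleSq (derivTheta (derivTheta w)) s :=
  wirtinger (fun θ => hasDerivAt_derivTheta (contDiffOn_derivTheta hw) hs θ)
    (continuous_slice (contDiffOn_derivTheta (contDiffOn_derivTheta hw)).continuousOn hs)
    (by have := derivTheta_periodic hper s 0; rwa [zero_add] at this)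
    (integral_derivTheta_eq_zero hw hper hs)

theorem norm_derivTheta_sq_le
    (hw : ContDiffOn ℝ ∞ (Function.uncurry w) (Ioo a b ×ˢ univ))
    (hper : ∀ s θ, w s (θ + 2 * Real.pi) = w s θ) {s : ℝ} (hs : s ∈ Ioo a b)
    {θ : ℝ} (hθ : θ ∈ Icc 0 (2 * Real.pi)) :
    ‖derivTheta w s θ‖ ^ 2 ≤
      3 * √(circleSq (derivTheta w) s * circleSq (derivTheta (derivTheta w)) s) :=
  norm_sq_le_of_mean_zero (fun θ => hasDerivAt_derivTheta (contDiffOn_derivTheta hw) hs θ)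
    (continuous_slice (contDiffOn_derivTheta (contDiffOn_derivTheta hw)).continuousOn hs)
    (by have := derivTheta_periodic hper s 0; rwa [zero_add] at this)
    (integral_derivTheta_eq_zero hw hper hs) hθ

theorem integral_inner_derivTheta {f g : ℝ → ℝ → EuclideanSpace ℝ (Fin k)}
    (hf : ContDiffOn ℝ ∞ (Function.uncurry f) (Ioo a b ×ˢ univ))
    (hg : ContDiffOn ℝ ∞ (Function.uncurry g) (Ioo a b ×ˢ univ))
    (hfper : ∀ s θ, f s (θ + 2 * Real.pi) = f s θ)
    (hgper : ∀ s θ, g s (θ + 2 * Real.pi) = g s θ) {s : ℝ} (hs : s ∈ Ioo a b) :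
    ∫ θ in (0 : ℝ)..(2 * Real.pi), inner ℝ (f s θ) (derivTheta g s θ) =
      -∫ θ in (0 : ℝ)..(2 * Real.pi), inner ℝ (derivTheta f s θ) (g s θ) := by
  have cf := continuous_slice hf.continuousOn hs
  have cg := continuous_slice hg.continuousOn hs
  have cf' := continuous_slice (contDiffOn_derivTheta hf).continuousOn hs
  have cg' := continuous_slice (contDiffOn_derivTheta hg).continuousOn hs
  have h := integral_eq_sub_of_hasDerivAt (a := 0) (b := 2 * Real.pi)
    (fun θ _ => (hasDerivAt_derivTheta hf hs θ).inner ℝ (hasDerivAt_derivTheta hg hs θ))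
    (Continuous.intervalIntegrable (by fun_prop) _ _)
  rw [integral_add (Continuous.intervalIntegrable (by fun_prop) _ _)
    (Continuous.intervalIntegrable (by fun_prop) _ _)] at h
  have h1 := hfper s 0
  have h2 := hgper s 0
  rw [zero_add] at h1 h2
  rw [h1, h2, sub_self] at h
  linarith

/-- The first derivative of the angular energy. -/
def angularDeriv (w : ℝ → ℝ → EuclideanSpace ℝ (Fin k)) (s : ℝ) : ℝ :=
  ∫ θ in (0 : ℝ)..(2 * Real.pi), 2 * inner ℝ (derivTheta w s θ) (derivS (derivTheta w) s θ)

/-- The second derivative of the angular energy. -/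
def angularDeriv2 (w : ℝ → ℝ → EuclideanSpace ℝ (Fin k)) (s : ℝ) : ℝ :=
  ∫ θ in (0 : ℝ)..(2 * Real.pi), (2 * ‖derivS (derivTheta w) s θ‖ ^ 2 +
    2 * inner ℝ (derivTheta w s θ) (derivS (derivS (derivTheta w)) s θ))

theorem hasDerivAt_angularDeriv (hw : ContDiffOn ℝ ∞ (Function.uncurry w) (Ioo a b ×ˢ univ))
    {s : ℝ} (hs : s ∈ Ioo a b) : HasDerivAt (angularDeriv w) (angularDeriv2 w s) s := by
  have h1 := contDiffOn_derivTheta hw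
  have h2 := contDiffOn_derivS h1
  have h3 := contDiffOn_derivS h2
  apply hasDerivAt_integral_slice
    (g := fun s θ => 2 * inner ℝ (derivTheta w s θ) (derivS (derivTheta w) s θ))
    (g' := fun s θ => 2 * ‖derivS (derivTheta w) s θ‖ ^ 2 +
      2 * inner ℝ (derivTheta w s θ) (derivS (derivS (derivTheta w)) s θ)) Real.two_pi_pos.le _ _ _ hs
  · exact continuousOn_const.mul (h1.continuousOn.inner (𝕜 := ℝ) h2.continuousOn)
  · exact (continuousOn_const.mul (h2.continuousOn.norm.pow 2)).add
      (continuousOn_const.mul (h1.continuousOn.inner (𝕜 := ℝ) h3.continuousOn))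
  · intro s hs θ
    refine (((hasDerivAt_derivS h1 hs θ).inner ℝ (hasDerivAt_derivS h2 hs θ)).const_mul
      2).congr_deriv ?_
    rw [real_inner_self_eq_norm_sq]
    ring

theorem continuousOn_angularDeriv2 (hw : ContDiffOn ℝ ∞ (Function.uncurry w) (Ioo a b ×ˢ univ)) :
    ContinuousOn (angularDeriv2 w) (Ioo a b) := by
  have h1 := contDiffOn_derivTheta hw
  have h2 := contDiffOn_derivS h1
  have h3 := contDiffOn_derivS h2
  exact continuousOn_integral_slice (g := fun s θ => 2 * ‖derivS (derivTheta w) s θ‖ ^ 2 +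
      2 * inner ℝ (derivTheta w s θ) (derivS (derivS (derivTheta w)) s θ)) Real.two_pi_pos.le
    ((continuousOn_const.mul (h2.continuousOn.norm.pow 2)).add
      (continuousOn_const.mul (h1.continuousOn.inner (𝕜 := ℝ) h3.continuousOn)))

theorem angularDeriv_sq_le (hw : ContDiffOn ℝ ∞ (Function.uncurry w) (Ioo a b ×ˢ univ))
    {s : ℝ} (hs : s ∈ Ioo a b) :
    angularDeriv w s ^ 2 ≤
      4 * circleSq (derivTheta w) s * circleSq (derivS (derivTheta w)) s := by
  have h1 := contDiffOn_derivTheta hw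
  have h2 := contDiffOn_derivS h1
  have h := integral_inner_sq_le Real.two_pi_pos.le (continuous_slice h1.continuousOn hs)
    (continuous_slice h2.continuousOn hs)
  rw [angularDeriv, intervalIntegral.integral_const_mul, mul_pow]
  unfold circleSq
  linarith

theorem derivS_derivS_derivTheta (hw : ContDiffOn ℝ ∞ (Function.uncurry w) (Ioo a b ×ˢ univ))
    {s : ℝ} (hs : s ∈ Ioo a b) (θ : ℝ) :
    derivS (derivS (derivTheta w)) s θ = derivTheta (derivS (derivS w)) s θ := by
  rw [← derivS_derivTheta_comm (contDiffOn_derivS hw) hs]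
  apply Filter.EventuallyEq.deriv_eq
  filter_upwards [Ioo_mem_nhds hs.1 hs.2] with x hx
  exact derivS_derivTheta_comm hw hx θ

/-- One θ-derivative of u_ssθ is moved onto u_θ; there is no boundary term by periodicity. This
exposes u_ss, which the tension equation can replace. -/
theorem angularDeriv2_eq (hw : ContDiffOn ℝ ∞ (Function.uncurry w) (Ioo a b ×ˢ univ))
    (hper : ∀ s θ, w s (θ + 2 * Real.pi) = w s θ) {s : ℝ} (hs : s ∈ Ioo a b) :
    angularDeriv2 w s = 2 * circleSq (derivS (derivTheta w)) s -
      ∫ θ in (0 : ℝ)..(2 * Real.pi),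
        2 * inner ℝ (derivTheta (derivTheta w) s θ) (derivS (derivS w) s θ) := by
  have h1 := contDiffOn_derivTheta hw
  have h2 := contDiffOn_derivS h1
  have h3 := contDiffOn_derivS h2
  have c1 := continuous_slice h1.continuousOn hs
  have c2 := continuous_slice h2.continuousOn hs
  have c3 := continuous_slice h3.continuousOn hs
  unfold angularDeriv2 circleSq
  rw [integral_add (Continuous.intervalIntegrable (by fun_prop) _ _)
    (Continuous.intervalIntegrable (by fun_prop) _ _), intervalIntegral.integral_const_mul,
    intervalIntegral.integral_const_mul, intervalIntegral.integral_const_mul]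
  have h := integral_inner_derivTheta h1 (contDiffOn_derivS (contDiffOn_derivS hw))
    (derivTheta_periodic hper) (derivS_periodic (derivS_periodic hper)) hs
  simp only [← derivS_derivS_derivTheta hw hs] at h
  rw [h]
  ring

variable {τ : ℝ → ℝ → EuclideanSpace ℝ (Fin k)} {M : ℝ}

/-- Substitute u_ss = τ - u_θθ + ν in -2∫⟨u_θθ, u_ss⟩. This yields 2B, minus the tension pairing,
which costs B/2 + 2T, minus the normal pairing, in which one factor |u_θ|² is replaced by its
supremum bound 3√(ϑB). -/
theorem le_angularDeriv2 (hw : ContDiffOn ℝ ∞ (Function.uncurry w) (Ioo a b ×ˢ univ))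
    (hper : ∀ s θ, w s (θ + 2 * Real.pi) = w s θ)
    (hτ : ContinuousOn (Function.uncurry τ) (Ioo a b ×ˢ univ)) (hM : 0 ≤ M)
    (hnormal : ∀ s ∈ Ioo a b, ∀ θ, |inner ℝ (derivTheta (derivTheta w) s θ)
      (derivTheta (derivTheta w) s θ + derivS (derivS w) s θ - τ s θ)| ≤
        M * ‖derivTheta w s θ‖ ^ 2 * (‖derivS w s θ‖ ^ 2 + ‖derivTheta w s θ‖ ^ 2))
    {s : ℝ} (hs : s ∈ Ioo a b) :
    2 * circleSq (derivS (derivTheta w)) s + 3 / 2 * circleSq (derivTheta (derivTheta w)) s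
      - 2 * circleSq τ s
      - 6 * M * √(circleSq (derivTheta w) s * circleSq (derivTheta (derivTheta w)) s) *
        (circleSq (derivS w) s + circleSq (derivTheta w) s) ≤ angularDeriv2 w s := by
  have c1 := continuous_slice (contDiffOn_derivTheta hw).continuousOn hs
  have c2 := continuous_slice (contDiffOn_derivS hw).continuousOn hs
  have c3 := continuous_slice (contDiffOn_derivTheta (contDiffOn_derivTheta hw)).continuousOn hs
  have c4 := continuous_slice (contDiffOn_derivS (contDiffOn_derivS hw)).continuousOn hs
  have c5 := continuous_slice hτ hs
  rw [angularDeriv2_eq hw hper hs]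
  set S := √(circleSq (derivTheta w) s * circleSq (derivTheta (derivTheta w)) s) with hS
  have hS0 : 0 ≤ S := Real.sqrt_nonneg _
  have key : ∫ θ in (0 : ℝ)..(2 * Real.pi),
        2 * inner ℝ (derivTheta (derivTheta w) s θ) (derivS (derivS w) s θ) ≤
      ∫ θ in (0 : ℝ)..(2 * Real.pi), ((-3 / 2) * ‖derivTheta (derivTheta w) s θ‖ ^ 2
        + 2 * ‖τ s θ‖ ^ 2
        + 6 * M * S * (‖derivS w s θ‖ ^ 2 + ‖derivTheta w s θ‖ ^ 2)) := by
    apply integral_mono_on Real.two_pi_pos.le (Continuous.intervalIntegrable (by fun_prop) _ _)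
      (Continuous.intervalIntegrable (by fun_prop) _ _)
    intro θ hθ
    have h1 := hnormal s hs θ
    have h2 := norm_derivTheta_sq_le hw hper hs hθ
    rw [← hS] at h2
    have h3 : M * ‖derivTheta w s θ‖ ^ 2 * (‖derivS w s θ‖ ^ 2 + ‖derivTheta w s θ‖ ^ 2) ≤
        M * (3 * S) * (‖derivS w s θ‖ ^ 2 + ‖derivTheta w s θ‖ ^ 2) := by gcongr
    have h4 := (abs_le.1 (h1.trans h3)).2
    rw [inner_sub_right, inner_add_right, real_inner_self_eq_norm_sq] at h4
    have h5 := real_inner_le_norm (derivTheta (derivTheta w) s θ) (τ s θ)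
    -- The weight 2 on τ fixes the split 2⟨u_θθ, τ⟩ ≤ |u_θθ|²/2 + 2|τ|², hence the factor 2 in front
    -- of the tension in the final estimate.
    have h6 := two_mul_le_add_sq (‖derivTheta (derivTheta w) s θ‖) (2 * ‖τ s θ‖)
    nlinarith
  rw [integral_add (Continuous.intervalIntegrable (by fun_prop) _ _)
      (Continuous.intervalIntegrable (by fun_prop) _ _),
    integral_add (Continuous.intervalIntegrable (by fun_prop) _ _)
      (Continuous.intervalIntegrable (by fun_prop) _ _),
    intervalIntegral.integral_const_mul (-3 / 2 : ℝ),
    intervalIntegral.integral_const_mul (2 : ℝ) (fun θ => ‖τ s θ‖ ^ 2),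
    intervalIntegral.integral_const_mul (6 * M * S),
    integral_add (Continuous.intervalIntegrable (by fun_prop) _ _)
      (Continuous.intervalIntegrable (by fun_prop) _ _)] at key
  change _ ≤ -3 / 2 * circleSq _ s + 2 * circleSq _ s + 6 * M * S * (circleSq _ s + circleSq _ s)
    at key
  linarith

/-- The `θ`-average of the real part of the Hopf differential is almost constant. -/
theorem hasDerivAt_hopfMean (hw : ContDiffOn ℝ ∞ (Function.uncurry w) (Ioo a b ×ˢ univ))
    (hper : ∀ s θ, w s (θ + 2 * Real.pi) = w s θ)
    (hτ : ContinuousOn (Function.uncurry τ) (Ioo a b ×ˢ univ))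
    (htang : ∀ s ∈ Ioo a b, ∀ θ, inner ℝ (derivS w s θ)
      (derivTheta (derivTheta w) s θ + derivS (derivS w) s θ - τ s θ) = 0)
    {s : ℝ} (hs : s ∈ Ioo a b) :
    HasDerivAt (fun s => circleSq (derivS w) s - circleSq (derivTheta w) s)
      (∫ θ in (0 : ℝ)..(2 * Real.pi), 2 * inner ℝ (derivS w s θ) (τ s θ)) s := by
  refine ((hasDerivAt_circleSq (contDiffOn_derivS hw) hs).sub
    (hasDerivAt_circleSq (contDiffOn_derivTheta hw) hs)).congr_deriv ?_
  have c1 := continuous_slice (contDiffOn_derivTheta hw).continuousOn hs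
  have c2 := continuous_slice (contDiffOn_derivS hw).continuousOn hs
  have c3 := continuous_slice (contDiffOn_derivTheta (contDiffOn_derivTheta hw)).continuousOn hs
  have c4 := continuous_slice (contDiffOn_derivS (contDiffOn_derivS hw)).continuousOn hs
  have c5 := continuous_slice hτ hs
  -- Integration by parts turns -∫⟨u_θ, u_sθ⟩ into ∫⟨u_θθ, u_s⟩. The derivative becomes 2∫⟨u_s, u_ss
  -- + u_θθ⟩, where only the tangential part of the Laplacian counts.
  have h := integral_inner_derivTheta (contDiffOn_derivTheta hw) (contDiffOn_derivS hw)
    (derivTheta_periodic hper) (derivS_periodic hper) hs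
  simp only [← derivS_derivTheta_comm hw hs] at h
  rw [intervalIntegral.integral_const_mul, intervalIntegral.integral_const_mul,
    intervalIntegral.integral_const_mul, h, ← mul_sub, sub_neg_eq_add,
    ← integral_add (Continuous.intervalIntegrable (by fun_prop) _ _)
      (Continuous.intervalIntegrable (by fun_prop) _ _)]
  congr 1
  apply integral_congr
  intro θ _
  have := htang s hs θ
  rw [inner_sub_right, inner_add_right] at this
  simp only
  linarith [real_inner_comm (derivS w s θ) (derivTheta (derivTheta w) s θ)]

/-- The derivative of the Hopf mean is bounded by energy density plus T, so on a unit interval it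
oscillates by at most δ + δ/2. Its average modulus is at most δ, and 5δ/2 ≤ 4δ. -/
theorem abs_hopfMean_le (hw : ContDiffOn ℝ ∞ (Function.uncurry w) (Ioo a b ×ˢ univ))
    (hper : ∀ s θ, w s (θ + 2 * Real.pi) = w s θ)
    (hτ : ContinuousOn (Function.uncurry τ) (Ioo a b ×ˢ univ))
    (htang : ∀ s ∈ Ioo a b, ∀ θ, inner ℝ (derivS w s θ)
      (derivTheta (derivTheta w) s θ + derivS (derivS w) s θ - τ s θ) = 0)
    {c δ : ℝ} (hc : Icc (c - 1 / 2) (c + 1 / 2) ⊆ Ioo a b)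
    (hE : ∫ s in (c - 1 / 2)..(c + 1 / 2), (circleSq (derivS w) s + circleSq (derivTheta w) s) ≤ δ)
    (hT : ∫ s in (c - 1 / 2)..(c + 1 / 2), circleSq τ s ≤ δ / 2)
    {s : ℝ} (hs : s ∈ Icc (c - 1 / 2) (c + 1 / 2)) :
    |circleSq (derivS w) s - circleSq (derivTheta w) s| ≤ 4 * δ := by
  have hle : c - 1 / 2 ≤ c + 1 / 2 := by linarith
  have cS := (continuousOn_circleSq (contDiffOn_derivS hw).continuousOn).mono hc
  have cT := (continuousOn_circleSq (contDiffOn_derivTheta hw).continuousOn).mono hc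
  have cτ := (continuousOn_circleSq hτ).mono hc
  have hint : ∀ g : ℝ → ℝ, ContinuousOn g (Icc (c - 1 / 2) (c + 1 / 2)) →
      IntervalIntegrable g volume (c - 1 / 2) (c + 1 / 2) := by
    intro g hg
    apply ContinuousOn.intervalIntegrable
    rwa [uIcc_of_le hle]
  set h : ℝ → ℝ := fun s => circleSq (derivS w) s - circleSq (derivTheta w) s with hh
  set h' : ℝ → ℝ := fun s => ∫ θ in (0 : ℝ)..(2 * Real.pi), 2 * inner ℝ (derivS w s θ) (τ s θ)
  have hd : ∀ s ∈ Icc (c - 1 / 2) (c + 1 / 2), HasDerivAt h (h' s) s := fun s hs =>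
    hasDerivAt_hopfMean hw hper hτ htang (hc hs)
  have ch' : ContinuousOn h' (Icc (c - 1 / 2) (c + 1 / 2)) :=
    (continuousOn_integral_slice (a := a) (b := b)
      (g := fun s θ => 2 * inner ℝ (derivS w s θ) (τ s θ))
      Real.two_pi_pos.le (by
        have := (contDiffOn_derivS hw).continuousOn
        simp only [Function.uncurry_def] at this hτ ⊢
        fun_prop)).mono hc
  have hb : ∀ s ∈ Icc (c - 1 / 2) (c + 1 / 2), |h' s| ≤
      (circleSq (derivS w) s + circleSq (derivTheta w) s) + circleSq τ s := by
    intro s hs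
    have c2 := continuous_slice (contDiffOn_derivS hw).continuousOn (hc hs)
    have c5 := continuous_slice hτ (hc hs)
    have h1 : |h' s| ≤ ∫ θ in (0 : ℝ)..(2 * Real.pi), (‖derivS w s θ‖ ^ 2 + ‖τ s θ‖ ^ 2) := by
      refine (abs_integral_le_integral_abs Real.two_pi_pos.le).trans ?_
      apply integral_mono_on Real.two_pi_pos.le (Continuous.intervalIntegrable (by fun_prop) _ _)
        (Continuous.intervalIntegrable (by fun_prop) _ _)
      intro θ _
      rw [abs_mul, abs_two]
      have := abs_real_inner_le_norm (derivS w s θ) (τ s θ)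
      have := two_mul_le_add_sq (‖derivS w s θ‖) (‖τ s θ‖)
      linarith
    rw [integral_add (Continuous.intervalIntegrable (by fun_prop) _ _)
        (Continuous.intervalIntegrable (by fun_prop) _ _)] at h1
    change |h' s| ≤ circleSq _ s + circleSq _ s at h1
    linarith [circleSq_nonneg (derivTheta w) s]
  have hosc : ∀ q ∈ Icc (c - 1 / 2) (c + 1 / 2), |h s| ≤ |h q| + 3 / 2 * δ := by
    intro q hq
    have hsub : uIoc q s ⊆ Ioc (c - 1 / 2) (c + 1 / 2) := by
      rw [uIoc]
      exact Ioc_subset_Ioc (le_min hq.1 hs.1) (max_le hq.2 hs.2)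
    have hsub' : uIcc q s ⊆ Icc (c - 1 / 2) (c + 1 / 2) := ordConnected_Icc.uIcc_subset hq hs
    have h1 : ∫ x in q..s, h' x = h s - h q :=
      integral_eq_sub_of_hasDerivAt (fun x hx => hd x (hsub' hx)) (ch'.mono hsub').intervalIntegrable
    have hI : IntegrableOn (fun x => |h' x|) (Ioc (c - 1 / 2) (c + 1 / 2)) :=
      (intervalIntegrable_iff_integrableOn_Ioc_of_le hle).1 (hint _ ch'.abs)
    have h2 : |h s - h q| ≤ ∫ x in (c - 1 / 2)..(c + 1 / 2), |h' x| := by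
      rw [← h1, ← Real.norm_eq_abs]
      refine (norm_integral_le_integral_norm_uIoc).trans ?_
      rw [integral_of_le hle]
      exact setIntegral_mono_set hI (Filter.Eventually.of_forall fun t => abs_nonneg _)
        (Filter.Eventually.of_forall hsub)
    have h3 : ∫ x in (c - 1 / 2)..(c + 1 / 2), |h' x| ≤ ∫ x in (c - 1 / 2)..(c + 1 / 2),
        ((circleSq (derivS w) x + circleSq (derivTheta w) x) + circleSq τ x) :=
      integral_mono_on hle (hint _ ch'.abs) (hint _ ((cS.add cT).add cτ)) hb
    rw [integral_add (hint (fun x => circleSq (derivS w) x + circleSq (derivTheta w) x)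
      (cS.add cT)) (hint _ cτ)] at h3
    have h4 : |h s| ≤ |h q| + |h s - h q| := by
      have := abs_add_le (h q) (h s - h q)
      rwa [add_sub_cancel] at this
    linarith
  have hch : ContinuousOn h (Icc (c - 1 / 2) (c + 1 / 2)) := cS.sub cT
  have h5 := integral_mono_on hle (f := fun _ => |h s| - 3 / 2 * δ)
    (g := fun s => circleSq (derivS w) s + circleSq (derivTheta w) s) (by simp)
    (hint _ (cS.add cT)) (fun q hq => by
      have h6 := hosc q hq
      have h7 : |h q| ≤ circleSq (derivS w) q + circleSq (derivTheta w) q := by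
        have := circleSq_nonneg (derivS w) q
        have := circleSq_nonneg (derivTheta w) q
        simp only [hh]
        rw [abs_le]
        constructor <;> linarith
      linarith)
  rw [intervalIntegral.integral_const, smul_eq_mul] at h5
  have h8 : c + 1 / 2 - (c - 1 / 2) = 1 := by ring
  rw [h8, one_mul] at h5
  have h9 : 0 ≤ |h s| := abs_nonneg _
  linarith

/-- The lower bound for ϑ'' is used twice. At first the energy on a circle is known only as 2ϑ + 4δ,
which gives the cubic inequality and hence ϑ ≤ 52δ at the centre. There the energy on the circle is
then at most 108δ, so the error term becomes a small multiple of B and the linear inequality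
follows. -/
theorem circleSq_derivTheta_le_of_small (hw : ContDiffOn ℝ ∞ (Function.uncurry w) (Ioo a b ×ˢ univ))
    (hper : ∀ s θ, w s (θ + 2 * Real.pi) = w s θ)
    (hτ : ContinuousOn (Function.uncurry τ) (Ioo a b ×ˢ univ)) (hM : 0 ≤ M)
    (htang : ∀ s ∈ Ioo a b, ∀ θ, inner ℝ (derivS w s θ)
      (derivTheta (derivTheta w) s θ + derivS (derivS w) s θ - τ s θ) = 0)
    (hnormal : ∀ s ∈ Ioo a b, ∀ θ, |inner ℝ (derivTheta (derivTheta w) s θ)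
      (derivTheta (derivTheta w) s θ + derivS (derivS w) s θ - τ s θ)| ≤
        M * ‖derivTheta w s θ‖ ^ 2 * (‖derivS w s θ‖ ^ 2 + ‖derivTheta w s θ‖ ^ 2))
    {c δ : ℝ} (hδ : 0 < δ) (hMδ : M * δ ≤ 1 / 1296)
    (hc : Icc (c - 1 / 2) (c + 1 / 2) ⊆ Ioo a b)
    (hE : ∫ s in (c - 1 / 2)..(c + 1 / 2), (circleSq (derivS w) s + circleSq (derivTheta w) s) ≤ δ)
    (hT : ∫ s in (c - 1 / 2)..(c + 1 / 2), circleSq τ s ≤ δ / 2) :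
    circleSq (derivTheta w) c ≤ 52 * δ ∧
      circleSq (derivTheta w) c - 2 * circleSq τ c ≤ angularDeriv2 w c := by
  have hle : c - 1 / 2 ≤ c + 1 / 2 := by linarith
  have hcc : c ∈ Icc (c - 1 / 2) (c + 1 / 2) := ⟨by linarith, by linarith⟩
  have h1 := contDiffOn_derivTheta hw
  have cS := (continuousOn_circleSq (contDiffOn_derivS hw).continuousOn).mono hc
  have cT := (continuousOn_circleSq h1.continuousOn).mono hc
  have cτ := (continuousOn_circleSq hτ).mono hc
  have cA := (continuousOn_circleSq (contDiffOn_derivS h1).continuousOn).mono hc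
  have cB := (continuousOn_circleSq (contDiffOn_derivTheta h1).continuousOn).mono hc
  have hopf := fun s hs => abs_hopfMean_le hw hper hτ htang hc hE hT (s := s) hs
  have hsum : ∀ s ∈ Icc (c - 1 / 2) (c + 1 / 2),
      circleSq (derivS w) s + circleSq (derivTheta w) s ≤
        2 * circleSq (derivTheta w) s + 4 * δ := fun s hs => by
    linarith [(abs_le.1 (hopf s hs)).2]
  have hineq := fun s hs => le_angularDeriv2 hw hper hτ hM hnormal (s := s) (hc hs)
  have hfirst : circleSq (derivTheta w) c ≤ 52 * δ := by
    refine le_of_cubic_differential_inequality (f := circleSq (derivTheta w))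
      (f' := angularDeriv w) (f'' := angularDeriv2 w)
      (D := fun s => circleSq (derivS (derivTheta w)) s + circleSq (derivTheta (derivTheta w)) s)
      (T := circleSq τ) (M := M)
      (fun x hx => hasDerivAt_circleSq h1 (hc hx)) (fun x hx => hasDerivAt_angularDeriv hw (hc hx))
      ((continuousOn_angularDeriv2 hw).mono hc) (cA.add cB) cτ (circleSq_nonneg _)
      (fun x => add_nonneg (circleSq_nonneg _ _) (circleSq_nonneg _ _)) (circleSq_nonneg _)
      ?_ hM hδ hMδ ?_ ?_ (by linarith)
    · intro x hx
      refine (angularDeriv_sq_le hw (hc hx)).trans ?_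
      have := mul_nonneg (circleSq_nonneg (derivTheta w) x)
        (circleSq_nonneg (derivTheta (derivTheta w)) x)
      linarith
    · intro x hx
      have k1 := hineq x hx
      have k2 := hsum x hx
      have hϑ := circleSq_nonneg (derivTheta w) x
      have hB := circleSq_nonneg (derivTheta (derivTheta w)) x
      have hA := circleSq_nonneg (derivS (derivTheta w)) x
      set ϑ := circleSq (derivTheta w) x
      set B := circleSq (derivTheta (derivTheta w)) x
      set S := √(ϑ * B)
      have hS : S ^ 2 = ϑ * B := Real.sq_sqrt (mul_nonneg hϑ hB)
      have hS0 : 0 ≤ S := Real.sqrt_nonneg _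
      have k3 := mul_le_mul_of_nonneg_left k2 (by positivity : 0 ≤ 6 * M * S)
      -- Arithmetic–geometric mean: since S² = ϑB, the square of the left side is four times the
      -- product of the two summands on the right.
      have k4 : 6 * M * S * (2 * ϑ + 4 * δ) ≤ 1 / 2 * B + 18 * M ^ 2 * ϑ * (2 * ϑ + 4 * δ) ^ 2 := by
        set X := 2 * ϑ + 4 * δ
        refine le_of_abs_le (abs_le_of_sq_le_sq ?_ (by positivity))
        have : (6 * M * S * X) ^ 2 = 4 * (1 / 2 * B) * (18 * M ^ 2 * ϑ * X ^ 2) := by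
          rw [mul_pow, mul_pow, hS]; ring
        rw [this]
        linarith [sq_nonneg (1 / 2 * B - 18 * M ^ 2 * ϑ * X ^ 2)]
      linarith
    · refine le_trans ?_ (hE.trans (by linarith))
      apply integral_mono_on hle
      · apply ContinuousOn.intervalIntegrable
        rwa [uIcc_of_le hle]
      · apply ContinuousOn.intervalIntegrable
        rw [uIcc_of_le hle]
        exact cS.add cT
      · exact fun x _ => le_add_of_nonneg_left (circleSq_nonneg _ _)
  refine ⟨hfirst, ?_⟩
  have k1 := hineq c hcc
  have k2 := hsum c hcc
  have hW := circleSq_derivTheta_le hw hper (hc hcc)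
  have hϑ := circleSq_nonneg (derivTheta w) c
  have hA := circleSq_nonneg (derivS (derivTheta w)) c
  set ϑ := circleSq (derivTheta w) c
  set B := circleSq (derivTheta (derivTheta w)) c
  -- Wirtinger's inequality ϑ ≤ B.
  have hS : √(ϑ * B) ≤ B := Real.sqrt_le_iff.2 ⟨hϑ.trans hW, by nlinarith⟩
  have hS0 : 0 ≤ √(ϑ * B) := Real.sqrt_nonneg _
  have k3 : 6 * M * √(ϑ * B) * (circleSq (derivS w) c + ϑ) ≤ 6 * M * B * (108 * δ) := by
    have := add_nonneg (circleSq_nonneg (derivS w) c) hϑ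
    have : 0 ≤ B := hϑ.trans hW
    gcongr
    linarith
  -- 6·108 = 648 is half of 1296, which is where the smallness condition on Mδ comes from. Of the
  -- 3/2 B there remains B ≥ ϑ.
  have k4 : 6 * M * B * (108 * δ) ≤ 1 / 2 * B := by
    have := mul_le_mul_of_nonneg_right hMδ (hϑ.trans hW)
    linarith
  linarith

theorem circleSq_derivTheta_le_cosh {L : ℝ} (hL : 1 ≤ L)
    (hw : ContDiffOn ℝ ∞ (Function.uncurry w) (Ioo (-L) L ×ˢ univ))
    (hper : ∀ s θ, w s (θ + 2 * Real.pi) = w s θ)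
    (hτ : ContinuousOn (Function.uncurry τ) (Ioo (-L) L ×ˢ univ)) (hM : 0 ≤ M)
    (htang : ∀ s ∈ Ioo (-L) L, ∀ θ, inner ℝ (derivS w s θ)
      (derivTheta (derivTheta w) s θ + derivS (derivS w) s θ - τ s θ) = 0)
    (hnormal : ∀ s ∈ Ioo (-L) L, ∀ θ, |inner ℝ (derivTheta (derivTheta w) s θ)
      (derivTheta (derivTheta w) s θ + derivS (derivS w) s θ - τ s θ)| ≤
        M * ‖derivTheta w s θ‖ ^ 2 * (‖derivS w s θ‖ ^ 2 + ‖derivTheta w s θ‖ ^ 2))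
    {δ : ℝ} (hδ : 0 < δ) (hMδ : M * δ ≤ 1 / 1296)
    (hE : ∀ c ∈ Icc (-(L - 1)) (L - 1), ∫ s in (c - 1 / 2)..(c + 1 / 2),
      (circleSq (derivS w) s + circleSq (derivTheta w) s) ≤ δ)
    (hT : ∀ c ∈ Icc (-(L - 1)) (L - 1), ∫ s in (c - 1 / 2)..(c + 1 / 2), circleSq τ s ≤ δ / 2) :
    ∀ s ∈ Icc (-(L - 1)) (L - 1), circleSq (derivTheta w) s ≤
      52 * δ * (Real.cosh s / Real.cosh (L - 1))
        + ∫ q in (-(L - 1))..(L - 1), Real.exp (-|s - q|) * circleSq τ q := by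
  have hsub : Icc (-(L - 1)) (L - 1) ⊆ Ioo (-L) L := Icc_subset_Ioo (by linarith) (by linarith)
  have key := fun c (hc : c ∈ Icc (-(L - 1)) (L - 1)) =>
    circleSq_derivTheta_le_of_small hw hper hτ hM htang hnormal hδ hMδ
      (c := c) (Icc_subset_Ioo (by linarith [hc.1]) (by linarith [hc.2])) (hE c hc) (hT c hc)
  exact le_cosh_add_integral_of_le_second_derivative (b := L) (by linarith) (by linarith)
    (fun x hx => hasDerivAt_circleSq (contDiffOn_derivTheta hw) (hsub hx))
    (fun x hx => hasDerivAt_angularDeriv hw (hsub hx)) (continuousOn_circleSq hτ)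
    (circleSq_nonneg _) (fun x hx => (key x (Ioo_subset_Icc_self hx)).2) (by positivity)
    (key _ ⟨le_rfl, by linarith⟩).1 (key _ ⟨by linarith, le_rfl⟩).1

end Strip

/-! ### Immersions of open subsets of a vector space -/

section Linear

variable {E H : Type*} [NormedAddCommGroup E] [NormedSpace ℝ E]
  [NormedAddCommGroup H] [InnerProductSpace ℝ H]

/-- The bilinear form induced on `E` by a linear map into an inner product space. -/
def pullbackInner (L : E →L[ℝ] H) : E →L[ℝ] E →L[ℝ] ℝ :=
  ((ContinuousLinearMap.compL ℝ E H ℝ).flip L).comp ((innerSL ℝ).comp L)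

theorem pullbackInner_apply (L : E →L[ℝ] H) (a b : E) :
    pullbackInner L a b = inner ℝ (L a) (L b) := rfl

variable [FiniteDimensional ℝ E]

/-- The orthogonal projection onto the range of a linear map. -/
def rangeProj (L : E →L[ℝ] H) : H →L[ℝ] H := (LinearMap.range L.toLinearMap).starProjection

theorem rangeProj_apply_self (L : E →L[ℝ] H) (a : E) : rangeProj L (L a) = L a :=
  Submodule.starProjection_eq_self_iff.2 ⟨a, rfl⟩

theorem norm_sub_rangeProj_le (L : E →L[ℝ] H) (y : H) : ‖y - rangeProj L y‖ ≤ ‖y‖ := by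
  have h := Submodule.norm_sq_eq_add_norm_sq_starProjection y (LinearMap.range L.toLinearMap)
  have h2 : (LinearMap.range L.toLinearMap)ᗮ.starProjection y = y - rangeProj L y :=
    Submodule.starProjection_orthogonal_val y
  rw [h2] at h
  exact le_of_sq_le_sq (by nlinarith [sq_nonneg ‖(LinearMap.range L.toLinearMap).starProjection y‖])
    (norm_nonneg _)

/-- Injectivity of L makes the pulled-back form positive definite, hence injective as a map to the
dual, which has the same dimension. -/
theorem isInvertible_pullbackInner {L : E →L[ℝ] H} (hL : Function.Injective L) :
    (pullbackInner L).IsInvertible := by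
  have hinj : Function.Injective (pullbackInner L).toLinearMap := by
    rw [← LinearMap.ker_eq_bot, LinearMap.ker_eq_bot']
    intro a ha
    have h1 : pullbackInner L a a = 0 := by
      have : pullbackInner L a = 0 := ha
      rw [this]; rfl
    rw [pullbackInner_apply, inner_self_eq_zero] at h1
    exact hL (by rw [h1, map_zero])
  have hfin : Module.finrank ℝ E = Module.finrank ℝ (E →L[ℝ] ℝ) := by
    rw [← (LinearMap.toContinuousLinearMap : (E →ₗ[ℝ] ℝ) ≃ₗ[ℝ] (E →L[ℝ] ℝ)).finrank_eq]
    exact Subspace.dual_finrank_eq.symm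
  refine ⟨(LinearEquiv.ofInjectiveOfFinrankEq (pullbackInner L).toLinearMap hinj
    hfin).toContinuousLinearEquiv, ?_⟩
  ext a : 1
  rfl

/-- The formula P = L(LᵀL)⁻¹Lᵀ, written with the dual space in place of an inner product on `E`. It
shows that P depends smoothly on an injective L. -/
theorem rangeProj_eq {L : E →L[ℝ] H} (hL : Function.Injective L) :
    rangeProj L = L.comp ((pullbackInner L).inverse.comp
      (((ContinuousLinearMap.compL ℝ E H ℝ).flip L).comp (innerSL ℝ))) := by
  ext1 y
  apply Submodule.eq_starProjection_of_mem_of_inner_eq_zero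
  · exact ⟨_, rfl⟩
  · rintro _ ⟨b, rfl⟩
    set φ : E →L[ℝ] ℝ := ((ContinuousLinearMap.compL ℝ E H ℝ).flip L) (innerSL ℝ y) with hφ
    have h1 : pullbackInner L ((pullbackInner L).inverse φ) = φ :=
      (isInvertible_pullbackInner hL).self_apply_inverse φ
    have h2 : inner ℝ (L ((pullbackInner L).inverse φ)) (L b) = inner ℝ y (L b) := by
      rw [← pullbackInner_apply, h1]; rfl
    rw [inner_sub_left]
    change _ - inner ℝ (L ((pullbackInner L).inverse φ)) (L b) = 0
    rw [h2]
    exact sub_self _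

theorem contDiffAt_rangeProj {X : Type*} [NormedAddCommGroup X] [NormedSpace ℝ X]
    {L : X → E →L[ℝ] H} {x : X} {m : ℕ∞ω} (hL : ContDiffAt ℝ m L x)
    (hinj : ∀ᶠ y in nhds x, Function.Injective (L y)) :
    ContDiffAt ℝ m (fun y => rangeProj (L y)) x := by
  have h : (fun y => rangeProj (L y)) =ᶠ[nhds x] fun y => (L y).comp ((pullbackInner (L y)).inverse.comp
      (((ContinuousLinearMap.compL ℝ E H ℝ).flip (L y)).comp (innerSL ℝ))) := by
    filter_upwards [hinj] with y hy using rangeProj_eq hy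
  refine ContDiffAt.congr_of_eventuallyEq ?_ h
  have hflip : ContDiffAt ℝ m (fun y => (ContinuousLinearMap.compL ℝ E H ℝ).flip (L y)) x :=
    ContDiffAt.comp x (g := fun T => (ContinuousLinearMap.compL ℝ E H ℝ).flip T)
      ((ContinuousLinearMap.compL ℝ E H ℝ).flip.isBoundedLinearMap.contDiff.contDiffAt) hL
  have hpull : ContDiffAt ℝ m (fun y => pullbackInner (L y)) x :=
    hflip.clm_comp (contDiffAt_const.clm_comp hL)
  have : CompleteSpace E := FiniteDimensional.complete ℝ E
  have hinv : ContDiffAt ℝ m (fun y => (pullbackInner (L y)).inverse) x :=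
    ContDiffAt.comp x (g := ContinuousLinearMap.inverse)
      (isInvertible_pullbackInner hinj.self_of_nhds).contDiffAt_map_inverse hpull
  exact hL.clm_comp (hinv.clm_comp (hflip.clm_comp contDiffAt_const))

end Linear

section Immersion

variable {E H H' : Type*} [NormedAddCommGroup E] [NormedSpace ℝ E]
  [NormedAddCommGroup H] [InnerProductSpace ℝ H]
  [NormedAddCommGroup H'] [InnerProductSpace ℝ H']
  {F : E → H} {F' : E → H'} {x : E}

theorem differentiableAt_fderiv (hF : ContDiffAt ℝ ∞ F x) : DifferentiableAt ℝ (fderiv ℝ F) x :=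
  (hF.fderiv_right (m := ∞) (by simp)).differentiableAt (by simp)

theorem hasDerivAt_comp_curve {v : ℝ → E} {s : ℝ} (hF : ContDiffAt ℝ 1 F (v s))
    (hv : ContDiffAt ℝ 1 v s) :
    HasDerivAt (fun t => F (v t)) (fderiv ℝ F (v s) (deriv v s)) s :=
  (hF.differentiableAt (by simp)).hasFDerivAt.comp_hasDerivAt s
    (hv.differentiableAt (by simp)).hasDerivAt

theorem contDiffAt_deriv {v : ℝ → E} {s : ℝ} (hv : ContDiffAt ℝ ∞ v s) :
    ContDiffAt ℝ ∞ (deriv v) s := by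
  have h := (hv.fderiv_right (m := ∞) (by simp)).clm_apply
    (contDiffAt_const (c := (1 : ℝ)))
  exact h

theorem deriv_deriv_comp_curve {v : ℝ → E} {s : ℝ} (hF : ContDiffAt ℝ ∞ F (v s))
    (hv : ContDiffAt ℝ ∞ v s) :
    deriv (deriv fun t => F (v t)) s =
      fderiv ℝ (fderiv ℝ F) (v s) (deriv v s) (deriv v s)
        + fderiv ℝ F (v s) (deriv (deriv v) s) := by
  have hev : (deriv fun t => F (v t)) =ᶠ[nhds s] fun t => fderiv ℝ F (v t) (deriv v t) := by
    have h1 := hv.continuousAt.eventually ((hF.of_le (m := 1) (by simp)).eventually (by simp))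
    have h2 := (hv.of_le (m := 1) (by simp)).eventually (by simp)
    filter_upwards [h1, h2] with t ht1 ht2 using (hasDerivAt_comp_curve ht1 ht2).deriv
  rw [hev.deriv_eq]
  have h1 : HasDerivAt (fun t => fderiv ℝ F (v t)) (fderiv ℝ (fderiv ℝ F) (v s) (deriv v s)) s :=
    (differentiableAt_fderiv hF).hasFDerivAt.comp_hasDerivAt s
      (hv.differentiableAt (by simp)).hasDerivAt
  have h2 : HasDerivAt (deriv v) (deriv (deriv v) s) s :=
    ((contDiffAt_deriv hv).differentiableAt (by simp)).hasDerivAt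
  exact (h1.clm_apply h2).deriv

/-- Differentiate the identity P(DF b) = DF b: the derivative of P applied to a tangent vector is
the normal part of D²F. -/
theorem fderiv_rangeProj_apply [FiniteDimensional ℝ E]
    (hF : ContDiffAt ℝ ∞ F x) (hinj : ∀ᶠ y in nhds x, Function.Injective (fderiv ℝ F y)) (a b : E) :
    fderiv ℝ (fun y => rangeProj (fderiv ℝ F y) (fderiv ℝ F x b)) x a =
      fderiv ℝ (fderiv ℝ F) x a b
        - rangeProj (fderiv ℝ F x) (fderiv ℝ (fderiv ℝ F) x a b) := by
  have hQ : DifferentiableAt ℝ (fun y => rangeProj (fderiv ℝ F y)) x :=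
    (contDiffAt_rangeProj (m := ∞) (hF.fderiv_right (by simp)) hinj).differentiableAt (by simp)
  have hD := differentiableAt_fderiv hF
  have h1 : HasFDerivAt (fun y => rangeProj (fderiv ℝ F y) (fderiv ℝ F y b)) _ x :=
    hQ.hasFDerivAt.clm_apply (hD.hasFDerivAt.clm_apply (hasFDerivAt_const b x))
  have h2 : HasFDerivAt (fun y => fderiv ℝ F y b) _ x :=
    hD.hasFDerivAt.clm_apply (hasFDerivAt_const b x)
  have h3 : (fun y => rangeProj (fderiv ℝ F y) (fderiv ℝ F y b)) = fun y => fderiv ℝ F y b :=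
    funext fun y => rangeProj_apply_self _ _
  rw [h3] at h1
  have h4 := congrArg (fun T => T a) (h1.unique h2)
  have h5 : HasFDerivAt (fun y => rangeProj (fderiv ℝ F y) (fderiv ℝ F x b)) _ x :=
    hQ.hasFDerivAt.clm_apply (hasFDerivAt_const (fderiv ℝ F x b) x)
  rw [h5.fderiv]
  simp at h4 ⊢
  exact eq_sub_of_add_eq' h4

/-- The component of the second derivative of an immersion along a tangent vector depends only on
the induced metric. -/
theorem inner_second_fderiv_eq (hF : ContDiffAt ℝ ∞ F x) (hF' : ContDiffAt ℝ ∞ F' x)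
    (h : ∀ᶠ y in nhds x, ∀ a b : E, (inner ℝ (fderiv ℝ F y a) (fderiv ℝ F y b) : ℝ) =
      inner ℝ (fderiv ℝ F' y a) (fderiv ℝ F' y b)) (a c : E) :
    (inner ℝ (fderiv ℝ (fderiv ℝ F) x a a) (fderiv ℝ F x c) : ℝ) =
      inner ℝ (fderiv ℝ (fderiv ℝ F') x a a) (fderiv ℝ F' x c) := by
  have hD := (differentiableAt_fderiv hF).hasFDerivAt
  have hD' := (differentiableAt_fderiv hF').hasFDerivAt
  have key : ∀ a b d : E,
      (inner ℝ (fderiv ℝ F x a) (fderiv ℝ (fderiv ℝ F) x d b) : ℝ)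
        + inner ℝ (fderiv ℝ (fderiv ℝ F) x d a) (fderiv ℝ F x b) =
      inner ℝ (fderiv ℝ F' x a) (fderiv ℝ (fderiv ℝ F') x d b)
        + inner ℝ (fderiv ℝ (fderiv ℝ F') x d a) (fderiv ℝ F' x b) := by
    intro a b d
    have h1 := (hD.clm_apply (hasFDerivAt_const a x)).inner ℝ
      (hD.clm_apply (hasFDerivAt_const b x))
    have h2 := (hD'.clm_apply (hasFDerivAt_const a x)).inner ℝ
      (hD'.clm_apply (hasFDerivAt_const b x))
    have h3 := h1.congr_of_eventuallyEq (h.mono fun y hy => (hy a b).symm)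
    have h4 := congrArg (fun T => T d) (h3.unique h2)
    simpa using h4
  have hsym : ∀ a b, fderiv ℝ (fderiv ℝ F) x a b = fderiv ℝ (fderiv ℝ F) x b a :=
    (hF.isSymmSndFDerivAt (by simpa using WithTop.coe_le_coe.2 (le_top : (2 : ℕ∞) ≤ ⊤))).eq
  have hsym' : ∀ a b, fderiv ℝ (fderiv ℝ F') x a b = fderiv ℝ (fderiv ℝ F') x b a :=
    (hF'.isSymmSndFDerivAt (by simpa using WithTop.coe_le_coe.2 (le_top : (2 : ℕ∞) ≤ ⊤))).eq
  -- The computation behind the Christoffel symbols: with subscripts for derivatives of F,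
  -- differentiating ⟨F_a, F_c⟩ along a gives ⟨F_aa, F_c⟩ + ⟨F_a, F_ac⟩, and differentiating ⟨F_a,
  -- F_a⟩ along c gives twice the unwanted term.
  have k1 := key a c a
  have k2 := key a a c
  rw [hsym c a, hsym' c a, real_inner_comm, real_inner_comm (fderiv ℝ (fderiv ℝ F') x a c)] at k2
  linarith [real_inner_comm (fderiv ℝ F x a) (fderiv ℝ (fderiv ℝ F) x a c),
    real_inner_comm (fderiv ℝ F' x a) (fderiv ℝ (fderiv ℝ F') x a c)]

end Immersion

/-! ### Isometric embeddings in charts -/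

section Chart

variable {n k : ℕ} {N : Type*} [TopologicalSpace N] [ChartedSpace (EuclideanSpace ℝ (Fin n)) N]

/-- A map `ι : N → ℝᵏ` in the chart at `p₀`. -/
def chartMap (ι : N → EuclideanSpace ℝ (Fin k)) (p₀ : N) :
    EuclideanSpace ℝ (Fin n) → EuclideanSpace ℝ (Fin k) :=
  fun x => ι ((extChartAt (𝓡 n) p₀).symm x)

/-- The differential of the chart at `p₀`, as a map between fixed vector spaces. -/
def chartDiff (p₀ p : N) (X : TangentSpace (𝓡 n) p) : EuclideanSpace ℝ (Fin n) :=
  mfderiv (𝓡 n) (𝓡 n) (extChartAt (𝓡 n) p₀) p X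

theorem eventually_mem_chart_image {p₀ p : N} (hp : p ∈ (extChartAt (𝓡 n) p₀).source) :
    ∀ᶠ y in nhds (extChartAt (𝓡 n) p₀ p), ∃ q ∈ (extChartAt (𝓡 n) p₀).source,
      extChartAt (𝓡 n) p₀ q = y := by
  filter_upwards [(isOpen_extChartAt_target p₀).mem_nhds ((extChartAt (𝓡 n) p₀).map_source hp)]
    with y hy
  exact ⟨_, (extChartAt (𝓡 n) p₀).map_target hy, (extChartAt (𝓡 n) p₀).right_inv hy⟩

theorem comp_curve_eventuallyEq {ι : N → EuclideanSpace ℝ (Fin k)} {p₀ : N} {c : ℝ → N} {s : ℝ}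
    (hc : ContinuousAt c s)
    (hs : c s ∈ (extChartAt (𝓡 n) p₀).source) :
    (fun t => ι (c t)) =ᶠ[nhds s] fun t => chartMap ι p₀ (extChartAt (𝓡 n) p₀ (c t)) := by
  filter_upwards [hc.preimage_mem_nhds ((isOpen_extChartAt_source p₀).mem_nhds hs)] with t ht
  rw [chartMap, (extChartAt (𝓡 n) p₀).left_inv ht]

variable [IsManifold (𝓡 n) ∞ N] {ι : N → EuclideanSpace ℝ (Fin k)} {p₀ p : N}

theorem contDiffAt_chartMap (hι : ContMDiff (𝓡 n) (𝓡 k) ∞ ι)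
    (hp : p ∈ (extChartAt (𝓡 n) p₀).source) :
    ContDiffAt ℝ ∞ (chartMap (n := n) ι p₀) (extChartAt (𝓡 n) p₀ p) := by
  have h1 : ContMDiffOn (𝓡 n) (𝓡 k) ∞ (chartMap (n := n) ι p₀) (extChartAt (𝓡 n) p₀).target :=
    hι.comp_contMDiffOn (contMDiffOn_extChartAt_symm p₀)
  exact (contMDiffOn_iff_contDiffOn.1 h1).contDiffAt
    ((isOpen_extChartAt_target p₀).mem_nhds ((extChartAt (𝓡 n) p₀).map_source hp))

theorem mdifferentiableAt_chart (hp : p ∈ (extChartAt (𝓡 n) p₀).source) :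
    MDifferentiableAt (𝓡 n) (𝓡 n) (extChartAt (𝓡 n) p₀) p :=
  have : IsManifold (𝓡 n) 1 N := .of_le (n := ∞) (by simp)
  mdifferentiableAt_extChartAt (by rwa [extChartAt_source] at hp)

theorem chartDiff_surjective (hp : p ∈ (extChartAt (𝓡 n) p₀).source) :
    Function.Surjective (chartDiff (n := n) p₀ p) := by
  have : IsManifold (𝓡 n) 1 N := .of_le (n := ∞) (by simp)
  exact (isInvertible_mfderiv_extChartAt hp).bijective.2

theorem differential_comp_chart {g : EuclideanSpace ℝ (Fin n) → EuclideanSpace ℝ (Fin k)}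
    {f : N → EuclideanSpace ℝ (Fin k)}
    (hp : p ∈ (extChartAt (𝓡 n) p₀).source)
    (hg : DifferentiableAt ℝ g (extChartAt (𝓡 n) p₀ p))
    (hfg : ∀ q ∈ (extChartAt (𝓡 n) p₀).source, f q = g (extChartAt (𝓡 n) p₀ q))
    (X : TangentSpace (𝓡 n) p) :
    differential f p X = fderiv ℝ g (extChartAt (𝓡 n) p₀ p) (chartDiff p₀ p X) := by
  have h1 : f =ᶠ[nhds p] g ∘ extChartAt (𝓡 n) p₀ :=
    Filter.eventuallyEq_of_mem ((isOpen_extChartAt_source p₀).mem_nhds hp) hfg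
  have h2 := mfderiv_comp_apply p (I' := 𝓡 n) hg.mdifferentiableAt (mdifferentiableAt_chart hp) X
  rw [mfderiv_eq_fderiv] at h2
  have h3 : differential f p = mfderiv (𝓡 n) (𝓡 k) (g ∘ extChartAt (𝓡 n) p₀) p :=
    h1.mfderiv_eq
  exact (congrArg (fun T => T X) h3).trans h2

theorem differential_eq (hι : ContMDiff (𝓡 n) (𝓡 k) ∞ ι)
    (hp : p ∈ (extChartAt (𝓡 n) p₀).source) (X : TangentSpace (𝓡 n) p) :
    differential ι p X =
      fderiv ℝ (chartMap ι p₀) (extChartAt (𝓡 n) p₀ p) (chartDiff p₀ p X) :=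
  differential_comp_chart hp ((contDiffAt_chartMap hι hp).differentiableAt (by simp))
    (fun q hq => by rw [chartMap, (extChartAt (𝓡 n) p₀).left_inv hq]) X

theorem tangentProj_eq (hι : ContMDiff (𝓡 n) (𝓡 k) ∞ ι)
    (hp : p ∈ (extChartAt (𝓡 n) p₀).source) :
    tangentProj (n := n) ι p = rangeProj (fderiv ℝ (chartMap ι p₀) (extChartAt (𝓡 n) p₀ p)) := by
  have h : tangentSubspace (n := n) ι p =
      LinearMap.range (fderiv ℝ (chartMap ι p₀) (extChartAt (𝓡 n) p₀ p)).toLinearMap := by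
    ext y
    constructor
    · rintro ⟨X, rfl⟩
      exact ⟨chartDiff p₀ p X, (differential_eq hι hp X).symm⟩
    · rintro ⟨x, rfl⟩
      obtain ⟨X, rfl⟩ := chartDiff_surjective hp x
      exact ⟨X, differential_eq hι hp X⟩
  unfold tangentProj rangeProj
  simp only [h]

section Curve

variable {c : ℝ → N} {s : ℝ}

theorem contDiffAt_chart_curve (hc : ContMDiffAt 𝓘(ℝ, ℝ) (𝓡 n) ∞ c s)
    (hs : c s ∈ (extChartAt (𝓡 n) p₀).source) :
    ContDiffAt ℝ ∞ (fun t => extChartAt (𝓡 n) p₀ (c t)) s := by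
  rw [extChartAt_source] at hs
  exact contMDiffAt_iff_contDiffAt.1 ((contMDiffAt_extChartAt' hs).comp s hc)

theorem deriv_chart_curve (hc : ContMDiffAt 𝓘(ℝ, ℝ) (𝓡 n) ∞ c s)
    (hs : c s ∈ (extChartAt (𝓡 n) p₀).source) :
    deriv (fun t => extChartAt (𝓡 n) p₀ (c t)) s =
      chartDiff p₀ (c s) (mfderiv 𝓘(ℝ, ℝ) (𝓡 n) c s (1 : ℝ)) := by
  have h := mfderiv_comp_apply s (I'' := 𝓡 n) (mdifferentiableAt_chart hs)
    (hc.mdifferentiableAt (by simp)) (1 : ℝ)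
  rw [mfderiv_eq_fderiv] at h
  exact h

theorem hasDerivAt_comp_curve_manifold (hι : ContMDiff (𝓡 n) (𝓡 k) ∞ ι)
    (hc : ContMDiffAt 𝓘(ℝ, ℝ) (𝓡 n) ∞ c s) :
    HasDerivAt (fun t => ι (c t)) (differential ι (c s) (mfderiv 𝓘(ℝ, ℝ) (𝓡 n) c s (1 : ℝ))) s := by
  have hs : c s ∈ (extChartAt (𝓡 n) (c s)).source := mem_extChartAt_source _
  rw [differential_eq hι hs, ← deriv_chart_curve hc hs]
  exact (hasDerivAt_comp_curve ((contDiffAt_chartMap hι hs).of_le (by simp))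
    ((contDiffAt_chart_curve hc hs).of_le (by simp))).congr_of_eventuallyEq
      (comp_curve_eventuallyEq hc.continuousAt hs)

theorem deriv_deriv_comp_curve_manifold (hι : ContMDiff (𝓡 n) (𝓡 k) ∞ ι)
    (hc : ContMDiffAt 𝓘(ℝ, ℝ) (𝓡 n) ∞ c s) (hs : c s ∈ (extChartAt (𝓡 n) p₀).source) :
    deriv (deriv fun t => ι (c t)) s =
      fderiv ℝ (fderiv ℝ (chartMap ι p₀)) (extChartAt (𝓡 n) p₀ (c s))
        (chartDiff p₀ (c s) (mfderiv 𝓘(ℝ, ℝ) (𝓡 n) c s (1 : ℝ)))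
        (chartDiff p₀ (c s) (mfderiv 𝓘(ℝ, ℝ) (𝓡 n) c s (1 : ℝ)))
      + fderiv ℝ (chartMap ι p₀) (extChartAt (𝓡 n) p₀ (c s))
        (deriv (deriv fun t => extChartAt (𝓡 n) p₀ (c t)) s) := by
  have h := deriv_deriv_comp_curve (v := fun t => extChartAt (𝓡 n) p₀ (c t))
    (contDiffAt_chartMap hι hs) (contDiffAt_chart_curve hc hs)
  rw [deriv_chart_curve hc hs] at h
  exact (comp_curve_eventuallyEq hc.continuousAt hs).deriv.deriv_eq.trans h

end Curve

variable {G : Bundle.ContMDiffRiemannianMetric (𝓡 n) ∞ (EuclideanSpace ℝ (Fin n))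
      (fun x : N => TangentSpace (𝓡 n) x)}

theorem differential_injective (hι : IsIsometricEmbedding G ι) :
    Function.Injective (differential (n := n) ι p) := by
  rw [injective_iff_map_eq_zero]
  intro X hX
  by_contra h
  have h1 := G.pos p X h
  rw [← hι.isometric, hX, inner_zero_left] at h1
  exact lt_irrefl _ h1

theorem fderiv_chartMap_injective (hι : IsIsometricEmbedding G ι)
    (hp : p ∈ (extChartAt (𝓡 n) p₀).source) :
    Function.Injective (fderiv ℝ (chartMap (n := n) ι p₀) (extChartAt (𝓡 n) p₀ p)) := by
  intro a b hab
  obtain ⟨X, rfl⟩ := chartDiff_surjective hp a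
  obtain ⟨Y, rfl⟩ := chartDiff_surjective hp b
  rw [← differential_eq hι.isSmoothEmbedding.contMDiff hp,
    ← differential_eq hι.isSmoothEmbedding.contMDiff hp] at hab
  rw [differential_injective hι hab]

theorem eventually_fderiv_chartMap_injective (hι : IsIsometricEmbedding G ι)
    (hp : p ∈ (extChartAt (𝓡 n) p₀).source) :
    ∀ᶠ y in nhds (extChartAt (𝓡 n) p₀ p),
      Function.Injective (fderiv ℝ (chartMap (n := n) ι p₀) y) := by
  filter_upwards [eventually_mem_chart_image hp] with y ⟨q, hq, hqy⟩
  rw [← hqy]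
  exact fderiv_chartMap_injective hι hq

/-- In a chart, A is minus the normal part of the Hessian of the parametrisation. This matches the
normal part of the second derivative of a curve, since its acceleration in the chart contributes
only a tangential vector. -/
theorem secondFundForm_eq (hι : IsIsometricEmbedding G ι)
    (hp : p ∈ (extChartAt (𝓡 n) p₀).source) (X Y : TangentSpace (𝓡 n) p) :
    secondFundForm ι p X Y =
      tangentProj (n := n) ι p (fderiv ℝ (fderiv ℝ (chartMap ι p₀)) (extChartAt (𝓡 n) p₀ p)
        (chartDiff p₀ p X) (chartDiff p₀ p Y))
      - fderiv ℝ (fderiv ℝ (chartMap ι p₀)) (extChartAt (𝓡 n) p₀ p)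
        (chartDiff p₀ p X) (chartDiff p₀ p Y) := by
  have hs := hι.isSmoothEmbedding.contMDiff
  have hF := contDiffAt_chartMap hs hp
  have hinj := eventually_fderiv_chartMap_injective hι hp
  have hQ : DifferentiableAt ℝ (fun y => rangeProj (fderiv ℝ (chartMap (n := n) ι p₀) y))
      (extChartAt (𝓡 n) p₀ p) :=
    (contDiffAt_rangeProj (m := ∞) (hF.fderiv_right (by simp)) hinj).differentiableAt (by simp)
  unfold secondFundForm
  rw [differential_comp_chart (g := fun y => rangeProj (fderiv ℝ (chartMap ι p₀) y)
      (differential ι p Y)) hp (hQ.clm_apply (differentiableAt_const _))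
      (fun q hq => by rw [tangentProj_eq hs hq]),
    differential_eq hs hp Y, fderiv_rangeProj_apply hF hinj, tangentProj_eq hs hp]
  abel

/-- The tangential part of the second derivative of a curve. -/
theorem deriv_deriv_add_secondFundForm (hι : IsIsometricEmbedding G ι) {c : ℝ → N} {s : ℝ}
    (hc : ContMDiffAt 𝓘(ℝ, ℝ) (𝓡 n) ∞ c s) :
    deriv (deriv fun t => ι (c t)) s + secondFundForm ι (c s)
      (mfderiv 𝓘(ℝ, ℝ) (𝓡 n) c s (1 : ℝ)) (mfderiv 𝓘(ℝ, ℝ) (𝓡 n) c s (1 : ℝ)) =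
    tangentProj (n := n) ι (c s) (deriv (deriv fun t => ι (c t)) s) := by
  have hs : c s ∈ (extChartAt (𝓡 n) (c s)).source := mem_extChartAt_source _
  rw [deriv_deriv_comp_curve_manifold hι.isSmoothEmbedding.contMDiff hc hs,
    secondFundForm_eq hι hs, map_add, tangentProj_eq hι.isSmoothEmbedding.contMDiff hs,
    rangeProj_apply_self]
  abel

theorem continuous_tangentProj (hι : IsIsometricEmbedding G ι) :
    Continuous (tangentProj (n := n) ι) := by
  rw [continuous_iff_continuousAt]
  intro p
  have hp : p ∈ (extChartAt (𝓡 n) p).source := mem_extChartAt_source _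
  have hs := hι.isSmoothEmbedding.contMDiff
  have hQ := (contDiffAt_rangeProj (m := ∞) ((contDiffAt_chartMap hs hp).fderiv_right (by simp))
    (eventually_fderiv_chartMap_injective hι hp)).continuousAt
  have h1 : tangentProj (n := n) ι =ᶠ[nhds p]
      (fun y => rangeProj (fderiv ℝ (chartMap (n := n) ι p) y)) ∘ extChartAt (𝓡 n) p :=
    Filter.eventuallyEq_of_mem ((isOpen_extChartAt_source p).mem_nhds hp)
      fun q hq => tangentProj_eq hs hq
  exact (ContinuousAt.comp hQ (continuousAt_extChartAt p)).congr h1.symm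

theorem inner_fderiv_chartMap_eq {k' : ℕ} {ι' : N → EuclideanSpace ℝ (Fin k')}
    (hι : IsIsometricEmbedding G ι) (hι' : IsIsometricEmbedding G ι')
    (hp : p ∈ (extChartAt (𝓡 n) p₀).source) (a b : EuclideanSpace ℝ (Fin n)) :
    (inner ℝ (fderiv ℝ (chartMap (n := n) ι p₀) (extChartAt (𝓡 n) p₀ p) a)
      (fderiv ℝ (chartMap (n := n) ι p₀) (extChartAt (𝓡 n) p₀ p) b) : ℝ) =
    inner ℝ (fderiv ℝ (chartMap (n := n) ι' p₀) (extChartAt (𝓡 n) p₀ p) a)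
      (fderiv ℝ (chartMap (n := n) ι' p₀) (extChartAt (𝓡 n) p₀ p) b) := by
  obtain ⟨X, rfl⟩ := chartDiff_surjective hp a
  obtain ⟨Y, rfl⟩ := chartDiff_surjective hp b
  rw [← differential_eq hι.isSmoothEmbedding.contMDiff hp,
    ← differential_eq hι.isSmoothEmbedding.contMDiff hp,
    ← differential_eq hι'.isSmoothEmbedding.contMDiff hp,
    ← differential_eq hι'.isSmoothEmbedding.contMDiff hp, hι.isometric, hι'.isometric]

/-- The tangential part of the second derivative of a curve is intrinsic. -/
theorem inner_deriv_deriv_eq {k' : ℕ} {ι' : N → EuclideanSpace ℝ (Fin k')}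
    (hι : IsIsometricEmbedding G ι) (hι' : IsIsometricEmbedding G ι') {c : ℝ → N} {s : ℝ}
    (hc : ContMDiffAt 𝓘(ℝ, ℝ) (𝓡 n) ∞ c s) (X : TangentSpace (𝓡 n) (c s)) :
    (inner ℝ (deriv (deriv fun t => ι (c t)) s) (differential ι (c s) X) : ℝ) =
      inner ℝ (deriv (deriv fun t => ι' (c t)) s) (differential ι' (c s) X) := by
  have hs : c s ∈ (extChartAt (𝓡 n) (c s)).source := mem_extChartAt_source _
  have h1 := hι.isSmoothEmbedding.contMDiff
  have h2 := hι'.isSmoothEmbedding.contMDiff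
  rw [deriv_deriv_comp_curve_manifold h1 hc hs, deriv_deriv_comp_curve_manifold h2 hc hs,
    differential_eq h1 hs, differential_eq h2 hs, inner_add_left, inner_add_left,
    inner_fderiv_chartMap_eq hι hι' hs,
    inner_second_fderiv_eq (contDiffAt_chartMap h1 hs) (contDiffAt_chartMap h2 hs)]
  filter_upwards [eventually_mem_chart_image hs] with y ⟨q, hq, hqy⟩ a b
  rw [← hqy]
  exact inner_fderiv_chartMap_eq hι hι' hq a b

/-- The normal part of the acceleration is that of D²F(a, a), with a the chart velocity. Near `p₀`
the Hessian is bounded and DF is uniformly bounded below, so |a| is controlled by the speed in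
Euclidean space. -/
theorem exists_nhds_norm_sub_tangentProj_le (hι : IsIsometricEmbedding G ι) (p₀ : N) :
    ∃ U ∈ nhds p₀, ∃ K : ℝ, ∀ (c : ℝ → N) (s : ℝ), ContMDiffAt 𝓘(ℝ, ℝ) (𝓡 n) ∞ c s → c s ∈ U →
      ‖deriv (deriv fun t => ι (c t)) s
        - tangentProj (n := n) ι (c s) (deriv (deriv fun t => ι (c t)) s)‖ ≤
      K * ‖deriv (fun t => ι (c t)) s‖ ^ 2 := by
  have hp : p₀ ∈ (extChartAt (𝓡 n) p₀).source := mem_extChartAt_source _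
  have h1 := hι.isSmoothEmbedding.contMDiff
  have hF := contDiffAt_chartMap h1 hp
  set x₀ := extChartAt (𝓡 n) p₀ p₀
  set F := chartMap (n := n) ι p₀
  obtain ⟨A, hA, hanti⟩ := LinearMap.exists_antilipschitzWith (fderiv ℝ F x₀).toLinearMap
    (LinearMap.ker_eq_bot.2 (fderiv_chartMap_injective hι hp))
  have hA0 : (0 : ℝ) < A := hA
  have hlow : ∀ a, ‖a‖ ≤ A * ‖fderiv ℝ F x₀ a‖ := fun a => by
    simpa using hanti.le_mul_norm (map_zero _) a
  have hc1 : ContinuousAt (fun y => ‖fderiv ℝ F y - fderiv ℝ F x₀‖) x₀ :=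
    (((differentiableAt_fderiv hF).continuousAt).sub continuousAt_const).norm
  have hc2 : ContinuousAt (fun y => ‖fderiv ℝ (fderiv ℝ F) y‖) x₀ :=
    ((hF.fderiv_right (m := ∞) (by simp)).fderiv_right (m := ∞) (by simp)).continuousAt.norm
  have hev1 : ∀ᶠ y in nhds x₀, ‖fderiv ℝ F y - fderiv ℝ F x₀‖ < 1 / (2 * A) :=
    hc1.eventually (gt_mem_nhds (by simpa using hA0))
  have hev2 : ∀ᶠ y in nhds x₀, ‖fderiv ℝ (fderiv ℝ F) y‖ < ‖fderiv ℝ (fderiv ℝ F) x₀‖ + 1 :=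
    hc2.eventually (gt_mem_nhds (lt_add_one _))
  have hev := (continuousAt_extChartAt (I := 𝓡 n) p₀).eventually (hev1.and hev2)
  refine ⟨_, Filter.inter_mem hev ((isOpen_extChartAt_source (I := 𝓡 n) p₀).mem_nhds hp),
    (‖fderiv ℝ (fderiv ℝ F) x₀‖ + 1) * (2 * A) ^ 2, ?_⟩
  rintro c s hc ⟨⟨hy1, hy2⟩, hs⟩
  rw [(hasDerivAt_comp_curve_manifold h1 hc).deriv, differential_eq h1 hs,
    deriv_deriv_comp_curve_manifold h1 hc hs, tangentProj_eq h1 hs, map_add, rangeProj_apply_self]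
  set a := chartDiff p₀ (c s) (mfderiv 𝓘(ℝ, ℝ) (𝓡 n) c s (1 : ℝ))
  set y := extChartAt (𝓡 n) p₀ (c s)
  -- The lower bound at the base point survives with constant 2A because DF has moved by less than
  -- 1/(2A).
  have hnorm : ‖a‖ ≤ 2 * A * ‖fderiv ℝ F y a‖ := by
    have e1 := hlow a
    have e2 : ‖fderiv ℝ F x₀ a‖ ≤ ‖fderiv ℝ F y a‖ + 1 / (2 * A) * ‖a‖ := by
      have e3 : ‖(fderiv ℝ F y - fderiv ℝ F x₀) a‖ ≤ 1 / (2 * A) * ‖a‖ :=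
        ((fderiv ℝ F y - fderiv ℝ F x₀).le_opNorm a).trans
          (mul_le_mul_of_nonneg_right hy1.le (norm_nonneg _))
      have e4 : fderiv ℝ F x₀ a = fderiv ℝ F y a - (fderiv ℝ F y - fderiv ℝ F x₀) a := by simp
      rw [e4]
      exact (norm_sub_le _ _).trans (by linarith)
    have e5 := mul_le_mul_of_nonneg_left e2 hA0.le
    have e6 : (A : ℝ) * (1 / (2 * A) * ‖a‖) = ‖a‖ / 2 := by field_simp
    rw [mul_add, e6] at e5
    linarith
  rw [add_sub_add_right_eq_sub]
  refine (norm_sub_rangeProj_le _ _).trans ?_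
  calc ‖fderiv ℝ (fderiv ℝ F) y a a‖ ≤ ‖fderiv ℝ (fderiv ℝ F) y‖ * ‖a‖ * ‖a‖ :=
        (fderiv ℝ (fderiv ℝ F) y).le_opNorm₂ a a
    _ ≤ (‖fderiv ℝ (fderiv ℝ F) x₀‖ + 1) * (2 * A * ‖fderiv ℝ F y a‖)
        * (2 * A * ‖fderiv ℝ F y a‖) := by
        gcongr
    _ = _ := by ring

/-- On a compact manifold, the normal part of the second derivative of a curve is bounded by a
multiple of the squared velocity. -/
theorem exists_norm_sub_tangentProj_le [CompactSpace N] (hι : IsIsometricEmbedding G ι) :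
    ∃ K : ℝ, 0 ≤ K ∧ ∀ (c : ℝ → N) (s : ℝ), ContMDiffAt 𝓘(ℝ, ℝ) (𝓡 n) ∞ c s →
      ‖deriv (deriv fun t => ι (c t)) s
        - tangentProj (n := n) ι (c s) (deriv (deriv fun t => ι (c t)) s)‖ ≤
      K * ‖deriv (fun t => ι (c t)) s‖ ^ 2 := by
  choose U hU K hK using exists_nhds_norm_sub_tangentProj_le hι
  obtain ⟨t, ht⟩ := CompactSpace.elim_nhds_subcover U hU
  refine ⟨∑ p ∈ t, |K p|, Finset.sum_nonneg fun _ _ => abs_nonneg _, fun c s hc => ?_⟩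
  have hmem : c s ∈ ⋃ p ∈ t, U p := ht ▸ mem_univ _
  obtain ⟨p, hpt, hp⟩ := mem_iUnion₂.1 hmem
  refine (hK p c s hc hp).trans (mul_le_mul_of_nonneg_right ?_ (by positivity))
  exact (le_abs_self _).trans
    (Finset.single_le_sum (f := fun p => |K p|) (fun _ _ => abs_nonneg _) hpt)

end Chart

/-! ### Maps from the cylinder -/

theorem coordMap_periodic {k : ℕ} {N : Type*} (ι : N → EuclideanSpace ℝ (Fin k))
    (u : ℝ × Circle → N) (s θ : ℝ) : coordMap ι u s (θ + 2 * Real.pi) = coordMap ι u s θ := by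
  unfold coordMap
  rw [Circle.periodic_exp θ]

section CylinderMap

variable {n k : ℕ} {N : Type*} [TopologicalSpace N] [ChartedSpace (EuclideanSpace ℝ (Fin n)) N]
  {ι : N → EuclideanSpace ℝ (Fin k)} {u : ℝ × Circle → N} {a b : ℝ}

theorem contMDiffOn_cover (hu : ContMDiffOn (𝓘(ℝ, ℝ).prod (𝓡 1)) (𝓡 n) ∞ u (cylinder a b)) :
    ContMDiffOn 𝓘(ℝ, ℝ × ℝ) (𝓡 n) ∞ (fun x : ℝ × ℝ => u (x.1, Circle.exp x.2))
      (Ioo a b ×ˢ univ) := by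
  have h : ContMDiff 𝓘(ℝ, ℝ × ℝ) (𝓘(ℝ, ℝ).prod (𝓡 1)) ∞
      (fun x : ℝ × ℝ => (x.1, Circle.exp x.2)) :=
    contDiff_fst.contMDiff.prodMk (contMDiff_circleExp.comp contDiff_snd.contMDiff)
  exact hu.comp h.contMDiffOn fun x hx => ⟨hx.1, mem_univ _⟩

theorem contMDiffAt_cover (hu : ContMDiffOn (𝓘(ℝ, ℝ).prod (𝓡 1)) (𝓡 n) ∞ u (cylinder a b))
    {s : ℝ} (hs : s ∈ Ioo a b) (θ : ℝ) :
    ContMDiffAt 𝓘(ℝ, ℝ × ℝ) (𝓡 n) ∞ (fun x : ℝ × ℝ => u (x.1, Circle.exp x.2)) (s, θ) :=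
  (contMDiffOn_cover hu).contMDiffAt (isOpen_strip.mem_nhds ⟨hs, mem_univ _⟩)

theorem contMDiffAt_curveS (hu : ContMDiffOn (𝓘(ℝ, ℝ).prod (𝓡 1)) (𝓡 n) ∞ u (cylinder a b))
    {s : ℝ} (hs : s ∈ Ioo a b) (θ : ℝ) :
    ContMDiffAt 𝓘(ℝ, ℝ) (𝓡 n) ∞ (fun s' : ℝ => u (s', Circle.exp θ)) s :=
  ContMDiffAt.comp s (f := fun s' : ℝ => (s', θ)) (contMDiffAt_cover hu hs θ)
    (contDiff_id.prodMk contDiff_const).contMDiff.contMDiffAt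

theorem contMDiffAt_curveTheta
    (hu : ContMDiffOn (𝓘(ℝ, ℝ).prod (𝓡 1)) (𝓡 n) ∞ u (cylinder a b))
    {s : ℝ} (hs : s ∈ Ioo a b) (θ : ℝ) :
    ContMDiffAt 𝓘(ℝ, ℝ) (𝓡 n) ∞ (fun θ' : ℝ => u (s, Circle.exp θ')) θ :=
  ContMDiffAt.comp θ (f := fun θ' : ℝ => (s, θ')) (contMDiffAt_cover hu hs θ)
    (contDiff_const.prodMk contDiff_id).contMDiff.contMDiffAt

theorem inner_differential_tangentProj (p : N) (X : TangentSpace (𝓡 n) p)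
    (y : EuclideanSpace ℝ (Fin k)) :
    (inner ℝ (differential ι p X) (y - tangentProj (n := n) ι p y) : ℝ) = 0 := by
  rw [real_inner_comm]
  exact Submodule.starProjection_inner_eq_zero (K := tangentSubspace (n := n) ι p) y _ ⟨X, rfl⟩

/-- A normal vector pairs only with the normal part of the other factor. This is what makes the
error term quadratic in the second fundamental form. -/
theorem inner_sub_tangentProj (p : N) (y z : EuclideanSpace ℝ (Fin k)) :
    (inner ℝ z (y - tangentProj (n := n) ι p y) : ℝ) =
      inner ℝ (z - tangentProj (n := n) ι p z) (y - tangentProj (n := n) ι p y) := by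
  obtain ⟨X, hX⟩ : tangentProj (n := n) ι p z ∈ tangentSubspace (n := n) ι p :=
    Submodule.starProjection_apply_mem _ z
  rw [inner_sub_left, ← hX]
  have := inner_differential_tangentProj (ι := ι) p X y
  exact (sub_eq_self.2 this).symm

variable [IsManifold (𝓡 n) ∞ N]
  {G : Bundle.ContMDiffRiemannianMetric (𝓡 n) ∞ (EuclideanSpace ℝ (Fin n))
    (fun x : N => TangentSpace (𝓡 n) x)}

theorem contDiffOn_coordMap (hι : IsIsometricEmbedding G ι)
    (hu : ContMDiffOn (𝓘(ℝ, ℝ).prod (𝓡 1)) (𝓡 n) ∞ u (cylinder a b)) :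
    ContDiffOn ℝ ∞ (Function.uncurry (coordMap ι u)) (Ioo a b ×ˢ univ) :=
  contMDiffOn_iff_contDiffOn.1
    (hι.isSmoothEmbedding.contMDiff.comp_contMDiffOn (contMDiffOn_cover hu))

theorem derivS_coordMap (hι : IsIsometricEmbedding G ι)
    (hu : ContMDiffOn (𝓘(ℝ, ℝ).prod (𝓡 1)) (𝓡 n) ∞ u (cylinder a b))
    {s : ℝ} (hs : s ∈ Ioo a b) (θ : ℝ) :
    derivS (coordMap ι u) s θ = differential ι (u (s, Circle.exp θ)) (tangentS (n := n) u s θ) :=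
  (hasDerivAt_comp_curve_manifold hι.isSmoothEmbedding.contMDiff (contMDiffAt_curveS hu hs θ)).deriv

theorem derivTheta_coordMap (hι : IsIsometricEmbedding G ι)
    (hu : ContMDiffOn (𝓘(ℝ, ℝ).prod (𝓡 1)) (𝓡 n) ∞ u (cylinder a b))
    {s : ℝ} (hs : s ∈ Ioo a b) (θ : ℝ) :
    derivTheta (coordMap ι u) s θ = differential ι (u (s, Circle.exp θ)) (tangentTheta (n := n) u s θ) :=
  (hasDerivAt_comp_curve_manifold hι.isSmoothEmbedding.contMDiff
    (contMDiffAt_curveTheta hu hs θ)).deriv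

/-- The tension is the tangential part of the Laplacian. -/
theorem tension_eq (hι : IsIsometricEmbedding G ι)
    (hu : ContMDiffOn (𝓘(ℝ, ℝ).prod (𝓡 1)) (𝓡 n) ∞ u (cylinder a b))
    {s : ℝ} (hs : s ∈ Ioo a b) (θ : ℝ) :
    tension (n := n) ι u s θ = tangentProj (n := n) ι (u (s, Circle.exp θ))
      (derivTheta (derivTheta (coordMap ι u)) s θ + derivS (derivS (coordMap ι u)) s θ) := by
  have h1 : derivS (derivS (coordMap ι u)) s θ + secondFundForm ι (u (s, Circle.exp θ))
      (tangentS u s θ) (tangentS u s θ) = tangentProj (n := n) ι (u (s, Circle.exp θ))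
        (derivS (derivS (coordMap ι u)) s θ) :=
    deriv_deriv_add_secondFundForm hι (contMDiffAt_curveS hu hs θ)
  have h2 : derivTheta (derivTheta (coordMap ι u)) s θ + secondFundForm ι (u (s, Circle.exp θ))
      (tangentTheta u s θ) (tangentTheta u s θ) = tangentProj (n := n) ι (u (s, Circle.exp θ))
        (derivTheta (derivTheta (coordMap ι u)) s θ) :=
    deriv_deriv_add_secondFundForm hι (contMDiffAt_curveTheta hu hs θ)
  rw [map_add, ← h1, ← h2, tension]
  abel

theorem continuousOn_tension (hι : IsIsometricEmbedding G ι)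
    (hu : ContMDiffOn (𝓘(ℝ, ℝ).prod (𝓡 1)) (𝓡 n) ∞ u (cylinder a b)) :
    ContinuousOn (Function.uncurry (tension (n := n) ι u)) (Ioo a b ×ˢ univ) := by
  have hw := contDiffOn_coordMap hι hu
  have h1 := (contDiffOn_derivTheta (contDiffOn_derivTheta hw)).continuousOn
  have h2 := (contDiffOn_derivS (contDiffOn_derivS hw)).continuousOn
  have h3 := (continuous_tangentProj hι).comp_continuousOn (contMDiffOn_cover hu).continuousOn
  exact (h3.clm_apply (h1.add h2)).congr fun x hx => tension_eq hι hu hx.1 x.2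

theorem inner_derivS_sub_tension (hι : IsIsometricEmbedding G ι)
    (hu : ContMDiffOn (𝓘(ℝ, ℝ).prod (𝓡 1)) (𝓡 n) ∞ u (cylinder a b))
    {s : ℝ} (hs : s ∈ Ioo a b) (θ : ℝ) :
    (inner ℝ (derivS (coordMap ι u) s θ) (derivTheta (derivTheta (coordMap ι u)) s θ
      + derivS (derivS (coordMap ι u)) s θ - tension (n := n) ι u s θ) : ℝ) = 0 := by
  rw [tension_eq hι hu hs, derivS_coordMap hι hu hs]
  exact inner_differential_tangentProj _ _ _

/-- Both factors may be replaced by their normal parts: that of u_θθ is at most K|u_θ|², that of the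
Laplacian at most K(|u_s|² + |u_θ|²). The factor |u_θ|² gained here is essential for decay. -/
theorem abs_inner_sub_tension_le (hι : IsIsometricEmbedding G ι)
    (hu : ContMDiffOn (𝓘(ℝ, ℝ).prod (𝓡 1)) (𝓡 n) ∞ u (cylinder a b)) {K : ℝ}
    (hK : ∀ (c : ℝ → N) (s : ℝ), ContMDiffAt 𝓘(ℝ, ℝ) (𝓡 n) ∞ c s →
      ‖deriv (deriv fun t => ι (c t)) s
        - tangentProj (n := n) ι (c s) (deriv (deriv fun t => ι (c t)) s)‖ ≤
      K * ‖deriv (fun t => ι (c t)) s‖ ^ 2)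
    {s : ℝ} (hs : s ∈ Ioo a b) (θ : ℝ) :
    |(inner ℝ (derivTheta (derivTheta (coordMap ι u)) s θ)
      (derivTheta (derivTheta (coordMap ι u)) s θ + derivS (derivS (coordMap ι u)) s θ
        - tension (n := n) ι u s θ) : ℝ)| ≤
      K ^ 2 * ‖derivTheta (coordMap ι u) s θ‖ ^ 2
        * (‖derivS (coordMap ι u) s θ‖ ^ 2 + ‖derivTheta (coordMap ι u) s θ‖ ^ 2) := by
  have h1 : ‖derivTheta (derivTheta (coordMap ι u)) s θ - tangentProj (n := n) ι
      (u (s, Circle.exp θ)) (derivTheta (derivTheta (coordMap ι u)) s θ)‖ ≤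
        K * ‖derivTheta (coordMap ι u) s θ‖ ^ 2 := hK _ θ (contMDiffAt_curveTheta hu hs θ)
  have h2 : ‖derivS (derivS (coordMap ι u)) s θ - tangentProj (n := n) ι
      (u (s, Circle.exp θ)) (derivS (derivS (coordMap ι u)) s θ)‖ ≤
        K * ‖derivS (coordMap ι u) s θ‖ ^ 2 := hK _ s (contMDiffAt_curveS hu hs θ)
  rw [tension_eq hι hu hs, inner_sub_tangentProj, map_add, add_sub_add_comm]
  refine (abs_real_inner_le_norm _ _).trans ?_
  calc _ ≤ (K * ‖derivTheta (coordMap ι u) s θ‖ ^ 2) *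
        (K * ‖derivTheta (coordMap ι u) s θ‖ ^ 2 + K * ‖derivS (coordMap ι u) s θ‖ ^ 2) :=
        mul_le_mul h1 ((norm_add_le _ _).trans (add_le_add h1 h2)) (norm_nonneg _)
          ((norm_nonneg _).trans h1)
    _ = _ := by ring

/-! ### Independence of the embedding -/

variable {k' : ℕ} {ι' : N → EuclideanSpace ℝ (Fin k')}

theorem inner_differential_eq (hι : IsIsometricEmbedding G ι) (hι' : IsIsometricEmbedding G ι')
    (p : N) (X Y : TangentSpace (𝓡 n) p) :
    (inner ℝ (differential ι p X) (differential ι p Y) : ℝ) =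
      inner ℝ (differential ι' p X) (differential ι' p Y) := by
  rw [hι.isometric, hι'.isometric]

theorem norm_differential_eq (hι : IsIsometricEmbedding G ι) (hι' : IsIsometricEmbedding G ι')
    (p : N) (X : TangentSpace (𝓡 n) p) :
    ‖differential (n := n) ι p X‖ = ‖differential (n := n) ι' p X‖ := by
  rw [← sq_eq_sq₀ (norm_nonneg _) (norm_nonneg _), ← real_inner_self_eq_norm_sq,
    ← real_inner_self_eq_norm_sq, inner_differential_eq hι hι']

/-- Both projections represent the same linear functional on the tangent space with respect to `G`,
so they have the same length. -/
theorem norm_tangentProj_eq (hι : IsIsometricEmbedding G ι) (hι' : IsIsometricEmbedding G ι')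
    (p : N) {y : EuclideanSpace ℝ (Fin k)} {y' : EuclideanSpace ℝ (Fin k')}
    (h : ∀ X : TangentSpace (𝓡 n) p,
      (inner ℝ y (differential ι p X) : ℝ) = inner ℝ y' (differential ι' p X)) :
    ‖tangentProj (n := n) ι p y‖ = ‖tangentProj (n := n) ι' p y'‖ := by
  obtain ⟨Y, hY⟩ : tangentProj (n := n) ι p y ∈ tangentSubspace (n := n) ι p :=
    Submodule.starProjection_apply_mem _ y
  obtain ⟨Y', hY'⟩ : tangentProj (n := n) ι' p y' ∈ tangentSubspace (n := n) ι' p :=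
    Submodule.starProjection_apply_mem _ y'
  have h1 : ∀ X : TangentSpace (𝓡 n) p, (inner ℝ (differential ι p Y) (differential ι p X) : ℝ) =
      inner ℝ (differential ι' p Y') (differential ι' p X) := by
    intro X
    have e1 := inner_differential_tangentProj (ι := ι) p X y
    have e2 := inner_differential_tangentProj (ι := ι') p X y'
    rw [← hY] at e1
    rw [← hY'] at e2
    rw [inner_sub_right, sub_eq_zero, real_inner_comm] at e1 e2
    have e3 := h X
    rw [e1, e2] at e3
    rw [real_inner_comm, real_inner_comm (differential ι' p X)]
    exact e3
  rw [← hY, ← hY']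
  change ‖differential ι p Y‖ = ‖differential ι' p Y'‖
  rw [← sq_eq_sq₀ (norm_nonneg _) (norm_nonneg _), ← real_inner_self_eq_norm_sq,
    ← real_inner_self_eq_norm_sq]
  calc (inner ℝ (differential ι p Y) (differential ι p Y) : ℝ)
      = inner ℝ (differential ι' p Y') (differential ι' p Y) := h1 Y
    _ = inner ℝ (differential ι p Y) (differential ι p Y') := by
        rw [inner_differential_eq hι hι' p Y Y', real_inner_comm]
    _ = inner ℝ (differential ι' p Y') (differential ι' p Y') := h1 Y'

theorem norm_derivS_eq (hι : IsIsometricEmbedding G ι) (hι' : IsIsometricEmbedding G ι')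
    (hu : ContMDiffOn (𝓘(ℝ, ℝ).prod (𝓡 1)) (𝓡 n) ∞ u (cylinder a b))
    {s : ℝ} (hs : s ∈ Ioo a b) (θ : ℝ) :
    ‖derivS (coordMap ι u) s θ‖ = ‖derivS (coordMap ι' u) s θ‖ := by
  rw [derivS_coordMap hι hu hs, derivS_coordMap hι' hu hs, norm_differential_eq hι hι']

theorem norm_derivTheta_eq (hι : IsIsometricEmbedding G ι) (hι' : IsIsometricEmbedding G ι')
    (hu : ContMDiffOn (𝓘(ℝ, ℝ).prod (𝓡 1)) (𝓡 n) ∞ u (cylinder a b))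
    {s : ℝ} (hs : s ∈ Ioo a b) (θ : ℝ) :
    ‖derivTheta (coordMap ι u) s θ‖ = ‖derivTheta (coordMap ι' u) s θ‖ := by
  rw [derivTheta_coordMap hι hu hs, derivTheta_coordMap hι' hu hs, norm_differential_eq hι hι']

theorem norm_tension_eq (hι : IsIsometricEmbedding G ι) (hι' : IsIsometricEmbedding G ι')
    (hu : ContMDiffOn (𝓘(ℝ, ℝ).prod (𝓡 1)) (𝓡 n) ∞ u (cylinder a b))
    {s : ℝ} (hs : s ∈ Ioo a b) (θ : ℝ) :
    ‖tension (n := n) ι u s θ‖ = ‖tension (n := n) ι' u s θ‖ := by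
  rw [tension_eq hι hu hs, tension_eq hι' hu hs]
  apply norm_tangentProj_eq hι hι'
  intro X
  rw [inner_add_left, inner_add_left]
  exact congrArg₂ (· + ·) (inner_deriv_deriv_eq hι hι' (contMDiffAt_curveTheta hu hs θ) X)
    (inner_deriv_deriv_eq hι hι' (contMDiffAt_curveS hu hs θ) X)

end CylinderMap

/-! ### Extended nonnegative integrals -/

theorem two_mul_ofReal (x : ℝ) : 2 * ENNReal.ofReal x = ENNReal.ofReal (2 * x) := by
  rw [ENNReal.ofReal_mul zero_le_two]
  simp

theorem ofReal_circleSq {E : Type*} [NormedAddCommGroup E] {f : ℝ → ℝ → E} {s : ℝ}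
    (hf : Continuous (f s)) :
    circleInt (fun s θ => ‖f s θ‖ₑ ^ 2) s = ENNReal.ofReal (circleSq f s) := by
  have hpi := Real.two_pi_pos
  unfold circleInt circleSq
  rw [integral_of_le hpi.le, ofReal_integral_eq_lintegral_ofReal]
  · refine lintegral_congr fun θ => ?_
    simp only
    rw [← ofReal_norm, ENNReal.ofReal_pow (norm_nonneg _)]
  · exact (Continuous.integrableOn_Icc (by fun_prop)).mono_set Ioc_subset_Icc_self
  · exact Filter.Eventually.of_forall fun θ => by positivity

theorem ofReal_intervalIntegral_le {g : ℝ → ℝ} {a b c d : ℝ} (hg : ContinuousOn g (Ioo a b))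
    (hg0 : ∀ x, 0 ≤ g x) (hcd : c ≤ d) (hsub : Icc c d ⊆ Ioo a b) :
    ENNReal.ofReal (∫ x in c..d, g x) ≤ ∫⁻ x in Ioo a b, ENNReal.ofReal (g x) := by
  rw [integral_of_le hcd, ofReal_integral_eq_lintegral_ofReal]
  · exact lintegral_mono_set (Ioc_subset_Icc_self.trans hsub)
  · exact (hg.mono hsub).integrableOn_Icc.mono_set Ioc_subset_Icc_self
  · exact Filter.Eventually.of_forall hg0

theorem circleInt_congr {f g : ℝ → ℝ → ℝ≥0∞} {s : ℝ} (h : ∀ θ, f s θ = g s θ) :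
    circleInt f s = circleInt g s :=
  lintegral_congr h

theorem cylInt_congr {f g : ℝ → ℝ → ℝ≥0∞} {a b : ℝ} (h : ∀ s ∈ Ioo a b, ∀ θ, f s θ = g s θ) :
    cylInt f a b = cylInt g a b :=
  setLIntegral_congr_fun measurableSet_Ioo fun s hs => circleInt_congr (h s hs)

theorem lintegral_exp_neg_abs_sub (q : ℝ) :
    ∫⁻ s : ℝ, ENNReal.ofReal (Real.exp (-|s - q|)) = 2 := by
  rw [lintegral_sub_right_eq_self (fun s => ENNReal.ofReal (Real.exp (-|s|))) q]
  have h : ∫ s : ℝ, Real.exp (-|s|) = 2 := by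
    rw [integral_comp_abs (f := fun s => Real.exp (-s)), integral_exp_neg_Ioi_zero, mul_one]
  rw [← ofReal_integral_eq_lintegral_ofReal, h]
  · simp
  · exact Integrable.of_integral_ne_zero (by rw [h]; norm_num)
  · exact Filter.Eventually.of_forall fun x => (Real.exp_pos _).le

theorem lintegral_exp_abs_sub_le {a L : ℝ} (ha : 0 ≤ a) :
    ∫⁻ s in Ioo (-a) a, ENNReal.ofReal (Real.exp (|s| - L)) ≤
      2 * ENNReal.ofReal (Real.exp (a - L)) := by
  have h1 : ∫ s in (-a)..a, (Real.exp s + Real.exp (-s)) ≤ 2 * Real.exp a := by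
    rw [integral_add (Continuous.intervalIntegrable (by fun_prop) _ _)
      (Continuous.intervalIntegrable (by fun_prop) _ _), integral_exp,
      integral_comp_neg (fun s => Real.exp s), integral_exp, neg_neg]
    linarith [Real.exp_pos (-a)]
  calc ∫⁻ s in Ioo (-a) a, ENNReal.ofReal (Real.exp (|s| - L))
      ≤ ∫⁻ s in Ioc (-a) a, ENNReal.ofReal (Real.exp (-L) * (Real.exp s + Real.exp (-s))) := by
        refine (lintegral_mono_set Ioo_subset_Ioc_self).trans (lintegral_mono fun s => ?_)
        apply ENNReal.ofReal_le_ofReal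
        rw [sub_eq_add_neg, Real.exp_add, mul_comm]
        gcongr
        rcases abs_cases s with ⟨h, _⟩ | ⟨h, _⟩ <;> rw [h]
        · linarith [Real.exp_pos (-s)]
        · linarith [Real.exp_pos s]
    _ = ENNReal.ofReal (∫ s in (-a)..a, Real.exp (-L) * (Real.exp s + Real.exp (-s))) := by
        rw [integral_of_le (by linarith), ofReal_integral_eq_lintegral_ofReal]
        · exact (Continuous.integrableOn_Icc (by fun_prop)).mono_set Ioc_subset_Icc_self
        · exact Filter.Eventually.of_forall fun x => by positivity
    _ ≤ ENNReal.ofReal (2 * Real.exp (a - L)) := by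
        apply ENNReal.ofReal_le_ofReal
        rw [intervalIntegral.integral_const_mul, sub_eq_add_neg, Real.exp_add]
        linarith [mul_le_mul_of_nonneg_left h1 (Real.exp_pos (-L)).le]
    _ = _ := (two_mul_ofReal _).symm

/-- Tonelli: each slice of the kernel has mass at most 2, which is the factor 2 before the squared
norm of τ. -/
theorem lintegral_lintegral_exp_mul_le {T : ℝ → ℝ≥0∞} {A B : Set ℝ}
    (hT : AEMeasurable T (volume.restrict B)) :
    ∫⁻ s in A, ∫⁻ q in B, ENNReal.ofReal (Real.exp (-|s - q|)) * T q ≤ 2 * ∫⁻ q in B, T q := by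
  rw [lintegral_lintegral_swap]
  · calc ∫⁻ q in B, ∫⁻ s in A, ENNReal.ofReal (Real.exp (-|s - q|)) * T q
        ≤ ∫⁻ q in B, 2 * T q := by
          refine lintegral_mono fun q => ?_
          rw [lintegral_mul_const _ (by fun_prop)]
          refine mul_le_mul_left ?_ _
          rw [← lintegral_exp_neg_abs_sub q]
          exact setLIntegral_le_lintegral _ _
      _ = _ := lintegral_const_mul' _ _ (by simp)
  · exact (Measurable.aemeasurable (by fun_prop)).mul hT.comp_snd

theorem cosh_div_cosh_le {s a : ℝ} : Real.cosh s / Real.cosh a ≤ 2 * Real.exp (|s| - a) := by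
  rw [div_le_iff₀ (Real.cosh_pos a), sub_eq_add_neg, Real.exp_add]
  have h1 : Real.cosh s ≤ Real.exp |s| := by
    rw [← Real.cosh_abs, Real.cosh_eq]
    have : Real.exp (-|s|) ≤ Real.exp |s| := Real.exp_le_exp.2 (by linarith [abs_nonneg s])
    linarith
  have h2 : 1 ≤ 2 * Real.exp (-a) * Real.cosh a := by
    rw [Real.cosh_eq]
    have : Real.exp (-a) * Real.exp a = 1 := by rw [← Real.exp_add]; simp
    nlinarith [Real.exp_pos (-a)]
  calc Real.cosh s ≤ Real.exp |s| * 1 := by rwa [mul_one]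
    _ ≤ Real.exp |s| * (2 * Real.exp (-a) * Real.cosh a) := by gcongr
    _ = _ := by ring

/-- Every unit neighbourhood in `(-L, L)` lies in an interval of length three in `(-L, L)`. -/
theorem exists_long_interval {L c : ℝ} (hL : 3 / 2 ≤ L) (hc : c ∈ Icc (-(L - 1)) (L - 1)) :
    ∃ s, -L ≤ s - 1 ∧ s + 2 ≤ L ∧ s ≤ c ∧ c ≤ s + 1 := by
  rcases le_total (c + 2) L with h | h
  · exact ⟨c, by linarith [hc.1], h, le_rfl, by linarith⟩
  · exact ⟨L - 2, by linarith, by linarith, by linarith, by linarith [hc.2]⟩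

/-! ### Assembly of the estimates and transfer between embeddings. -/

section Main

variable {n k : ℕ} {N : Type*} [TopologicalSpace N] [ChartedSpace (EuclideanSpace ℝ (Fin n)) N]
  [IsManifold (𝓡 n) ∞ N]
  {G : Bundle.ContMDiffRiemannianMetric (𝓡 n) ∞ (EuclideanSpace ℝ (Fin n))
    (fun x : N => TangentSpace (𝓡 n) x)}
  {ι : N → EuclideanSpace ℝ (Fin k)} {u : ℝ × Circle → N}

theorem circleInt_energy_density {w : ℝ → ℝ → EuclideanSpace ℝ (Fin k)} {a b : ℝ}
    (hw : ContDiffOn ℝ ∞ (Function.uncurry w) (Ioo a b ×ˢ univ)) {s : ℝ} (hs : s ∈ Ioo a b) :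
    circleInt (fun s θ => ‖derivS w s θ‖ₑ ^ 2 + ‖derivTheta w s θ‖ₑ ^ 2) s =
      ENNReal.ofReal (circleSq (derivS w) s + circleSq (derivTheta w) s) := by
  have c1 := continuous_slice (contDiffOn_derivS hw).continuousOn hs
  have c2 := continuous_slice (contDiffOn_derivTheta hw).continuousOn hs
  rw [ENNReal.ofReal_add (circleSq_nonneg _ _) (circleSq_nonneg _ _), ← ofReal_circleSq c1,
    ← ofReal_circleSq c2]
  exact lintegral_add_left (by fun_prop) _

/-- The decay estimate for the angular energy when the constant bounding the second fundamental
form is given. -/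
theorem angularEnergy_le (hι : IsIsometricEmbedding G ι) {K : ℝ}
    (hK : ∀ (c : ℝ → N) (s : ℝ), ContMDiffAt 𝓘(ℝ, ℝ) (𝓡 n) ∞ c s →
      ‖deriv (deriv fun t => ι (c t)) s
        - tangentProj (n := n) ι (c s) (deriv (deriv fun t => ι (c t)) s)‖ ≤
      K * ‖deriv (fun t => ι (c t)) s‖ ^ 2)
    {δ : ℝ} (hδ : 0 < δ) (hδ1 : δ ≤ 1) (hKδ : K ^ 2 * δ ≤ 1 / 1296) {L : ℝ} (hL : 3 / 2 ≤ L)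
    (hu : ContMDiffOn (𝓘(ℝ, ℝ).prod (𝓡 1)) (𝓡 n) ∞ u (cylinder (-L) L))
    (hE : ∀ s : ℝ, cylinder (s - 1) (s + 2) ⊆ cylinder (-L) L →
      energy ι u (s - 1) (s + 2) < ENNReal.ofReal (δ / 2))
    (hT : tensionL2Sq (n := n) ι u (-L) L < ENNReal.ofReal (δ / 2)) {s : ℝ}
    (hs : s ∈ Ioo (-L + 1) (L - 1)) :
    angularEnergy ι u s ≤ 312 * ENNReal.ofReal (Real.exp (|s| - L))
      + ∫⁻ q in Ioo (-L) L,
        ENNReal.ofReal (Real.exp (-|s - q|)) * tensionCircle (n := n) ι u q := by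
  set w := coordMap ι u with hwdef
  set τ := tension (n := n) ι u
  have hw : ContDiffOn ℝ ∞ (Function.uncurry w) (Ioo (-L) L ×ˢ univ) := contDiffOn_coordMap hι hu
  have hτ : ContinuousOn (Function.uncurry τ) (Ioo (-L) L ×ˢ univ) := continuousOn_tension hι hu
  have hTq : ∀ q ∈ Ioo (-L) L, tensionCircle (n := n) ι u q = ENNReal.ofReal (circleSq τ q) :=
    fun q hq => ofReal_circleSq (continuous_slice hτ hq)
  have cE : ContinuousOn (fun s => circleSq (derivS w) s + circleSq (derivTheta w) s)
      (Ioo (-L) L) :=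
    (continuousOn_circleSq (contDiffOn_derivS hw).continuousOn).add
      (continuousOn_circleSq (contDiffOn_derivTheta hw).continuousOn)
  have hE' : ∀ c ∈ Icc (-(L - 1)) (L - 1), ∫ s in (c - 1 / 2)..(c + 1 / 2),
      (circleSq (derivS w) s + circleSq (derivTheta w) s) ≤ δ := by
    intro c hc
    obtain ⟨r, h1, h2, h3, h4⟩ := exists_long_interval hL hc
    have hsub : Ioo (r - 1) (r + 2) ⊆ Ioo (-L) L := Ioo_subset_Ioo h1 h2
    have e1 := hE r (prod_mono hsub le_rfl)
    have e2 := ofReal_intervalIntegral_le (c := c - 1 / 2) (d := c + 1 / 2) (cE.mono hsub)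
      (fun x => add_nonneg (circleSq_nonneg _ _) (circleSq_nonneg _ _)) (by linarith)
      (Icc_subset_Ioo (by linarith) (by linarith))
    have e3 : energy ι u (r - 1) (r + 2) = 2⁻¹ * ∫⁻ s in Ioo (r - 1) (r + 2),
        ENNReal.ofReal (circleSq (derivS w) s + circleSq (derivTheta w) s) := by
      unfold energy cylInt
      congr 1
      exact setLIntegral_congr_fun measurableSet_Ioo fun s hs => circleInt_energy_density hw (hsub hs)
    rw [e3] at e1
    have e4 : ENNReal.ofReal (∫ s in (c - 1 / 2)..(c + 1 / 2),
        (circleSq (derivS w) s + circleSq (derivTheta w) s)) ≤ ENNReal.ofReal δ := by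
      refine e2.trans ?_
      have e5 := mul_le_mul_right e1.le 2
      rwa [← mul_assoc, ENNReal.mul_inv_cancel two_ne_zero ENNReal.ofNat_ne_top, one_mul,
        two_mul_ofReal, mul_div_cancel₀ _ two_ne_zero]
        at e5
    exact (ENNReal.ofReal_le_ofReal_iff hδ.le).1 e4
  have hT' : ∀ c ∈ Icc (-(L - 1)) (L - 1),
      ∫ s in (c - 1 / 2)..(c + 1 / 2), circleSq τ s ≤ δ / 2 := by
    intro c hc
    refine (ENNReal.ofReal_le_ofReal_iff (by positivity)).1 (le_trans ?_ hT.le)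
    refine (ofReal_intervalIntegral_le (continuousOn_circleSq hτ) (circleSq_nonneg _) (by linarith)
      (Icc_subset_Ioo (by linarith [hc.1]) (by linarith [hc.2]))).trans_eq ?_
    exact setLIntegral_congr_fun measurableSet_Ioo fun q hq => (hTq q hq).symm
  have hsL : s ∈ Ioo (-L) L := ⟨by linarith [hs.1], by linarith [hs.2]⟩
  have key := circleSq_derivTheta_le_cosh (by linarith) hw (coordMap_periodic ι u) hτ (sq_nonneg K)
    (fun s hs θ => inner_derivS_sub_tension hι hu hs θ)
    (fun s hs θ => abs_inner_sub_tension_le hι hu hK hs θ) hδ hKδ hE' hT' s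
    ⟨by linarith [hs.1], hs.2.le⟩
  have hang : angularEnergy ι u s = ENNReal.ofReal (circleSq (derivTheta w) s) :=
    ofReal_circleSq (continuous_slice (contDiffOn_derivTheta hw).continuousOn hsL)
  rw [hang]
  refine (ENNReal.ofReal_le_ofReal key).trans (ENNReal.ofReal_add_le.trans (add_le_add ?_ ?_))
  · rw [← ENNReal.ofReal_ofNat 312, ← ENNReal.ofReal_mul (by norm_num)]
    apply ENNReal.ofReal_le_ofReal
    -- The comparison runs on [-(L-1), L-1], which costs a factor e ≤ 3. With δ ≤ 1 the constant is
    -- 52·2·3 = 312.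
    have h1 := cosh_div_cosh_le (s := s) (a := L - 1)
    have h2 : |s| - (L - 1) = (|s| - L) + 1 := by ring
    rw [h2, Real.exp_add] at h1
    have h3 : Real.exp 1 ≤ 3 := Real.exp_one_lt_three.le
    have h4 := Real.exp_pos (|s| - L)
    have h5 : 0 ≤ Real.cosh s / Real.cosh (L - 1) :=
      div_nonneg (Real.cosh_pos _).le (Real.cosh_pos _).le
    calc 52 * δ * (Real.cosh s / Real.cosh (L - 1)) ≤ 52 * 1 * (2 * (Real.exp (|s| - L) * 3)) := by
          gcongr
          refine h1.trans ?_
          gcongr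
      _ = _ := by ring
  · refine (ofReal_intervalIntegral_le (a := -L) (b := L)
      (g := fun q => Real.exp (-|s - q|) * circleSq τ q) ?_
      (fun q => mul_nonneg (Real.exp_pos _).le (circleSq_nonneg _ _)) (by linarith)
      (Icc_subset_Ioo (by linarith) (by linarith))).trans_eq ?_
    · exact ContinuousOn.mul (by fun_prop) (continuousOn_circleSq hτ)
    · refine setLIntegral_congr_fun measurableSet_Ioo fun q hq => ?_
      rw [ENNReal.ofReal_mul (Real.exp_pos _).le, hTq q hq]

theorem lintegral_angularEnergy_le (hι : IsIsometricEmbedding G ι) {L l : ℝ}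
    (hu : ContMDiffOn (𝓘(ℝ, ℝ).prod (𝓡 1)) (𝓡 n) ∞ u (cylinder (-L) L))
    (h : ∀ s ∈ Ioo (-L + 1) (L - 1), angularEnergy ι u s ≤
      312 * ENNReal.ofReal (Real.exp (|s| - L)) + ∫⁻ q in Ioo (-L) L,
        ENNReal.ofReal (Real.exp (-|s - q|)) * tensionCircle (n := n) ι u q)
    (hl : 1 < l) (hlL : l < L) :
    ∫⁻ s in Ioo (-L + l) (L - l), angularEnergy ι u s ≤
      624 * ENNReal.ofReal (Real.exp (-l)) + 2 * tensionL2Sq (n := n) ι u (-L) L := by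
  have hτ := continuousOn_tension hι hu
  have hmeas : AEMeasurable (tensionCircle (n := n) ι u) (volume.restrict (Ioo (-L) L)) := by
    have h1 : AEMeasurable (fun q => ENNReal.ofReal (circleSq (tension (n := n) ι u) q))
        (volume.restrict (Ioo (-L) L)) :=
      ((continuousOn_circleSq hτ).aemeasurable measurableSet_Ioo).ennreal_ofReal
    refine h1.congr ?_
    filter_upwards [ae_restrict_mem measurableSet_Ioo] with q hq
    exact (ofReal_circleSq (continuous_slice hτ hq)).symm
  have hI : Ioo (-L + l) (L - l) = Ioo (-(L - l)) (L - l) := by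
    congr 1; ring
  calc ∫⁻ s in Ioo (-L + l) (L - l), angularEnergy ι u s
      ≤ ∫⁻ s in Ioo (-L + l) (L - l), (312 * ENNReal.ofReal (Real.exp (|s| - L))
        + ∫⁻ q in Ioo (-L) L,
          ENNReal.ofReal (Real.exp (-|s - q|)) * tensionCircle (n := n) ι u q) :=
        setLIntegral_mono' measurableSet_Ioo fun s hs =>
          h s ⟨by linarith [hs.1], by linarith [hs.2]⟩
    _ = 312 * (∫⁻ s in Ioo (-L + l) (L - l), ENNReal.ofReal (Real.exp (|s| - L)))
        + ∫⁻ s in Ioo (-L + l) (L - l), ∫⁻ q in Ioo (-L) L,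
          ENNReal.ofReal (Real.exp (-|s - q|)) * tensionCircle (n := n) ι u q := by
        rw [lintegral_add_left (by fun_prop), lintegral_const_mul' _ _ (by simp)]
    _ ≤ 312 * (2 * ENNReal.ofReal (Real.exp (L - l - L)))
        + 2 * tensionL2Sq (n := n) ι u (-L) L := by
        gcongr
        · rw [hI]
          exact lintegral_exp_abs_sub_le (by linarith)
        · exact lintegral_lintegral_exp_mul_le hmeas
    _ = _ := by
        rw [← mul_assoc]
        norm_num

/-- The real part of φ is |u_s|² - |u_θ|², so half the energy density is at most |u_θ|² + |φ|/2. As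
‖Φ‖ = 2∫|φ|, the last term contributes a quarter of ‖Φ‖. -/
theorem energy_le_angularEnergy_add_hopfL1 (hι : IsIsometricEmbedding G ι) {a b : ℝ}
    (hu : ContMDiffOn (𝓘(ℝ, ℝ).prod (𝓡 1)) (𝓡 n) ∞ u (cylinder a b)) :
    energy ι u a b ≤ (∫⁻ s in Ioo a b, angularEnergy ι u s) + 4⁻¹ * hopfL1 ι u a b := by
  have hw := contDiffOn_coordMap hι hu
  have hpt : ∀ s θ, ‖derivS (coordMap ι u) s θ‖ₑ ^ 2 + ‖derivTheta (coordMap ι u) s θ‖ₑ ^ 2 ≤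
      2 * ‖derivTheta (coordMap ι u) s θ‖ₑ ^ 2 + ‖hopfCoeff ι u s θ‖ₑ := by
    intro s θ
    have h1 : ‖derivS (coordMap ι u) s θ‖ ^ 2 - ‖derivTheta (coordMap ι u) s θ‖ ^ 2 ≤
        ‖hopfCoeff ι u s θ‖ := by
      refine le_trans (le_of_eq ?_) (Complex.re_le_norm _)
      rw [hopfCoeff, Complex.sub_re, Complex.ofReal_re]
      simp
    rw [← ofReal_norm, ← ofReal_norm, ← ofReal_norm,
      ← ENNReal.ofReal_pow (norm_nonneg _), ← ENNReal.ofReal_pow (norm_nonneg _),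
      two_mul_ofReal,
      ← ENNReal.ofReal_add (by positivity) (by positivity),
      ← ENNReal.ofReal_add (by positivity) (by positivity)]
    exact ENNReal.ofReal_le_ofReal (by linarith)
  have hcirc : ∀ s ∈ Ioo a b, circleInt (fun s θ => ‖derivS (coordMap ι u) s θ‖ₑ ^ 2
      + ‖derivTheta (coordMap ι u) s θ‖ₑ ^ 2) s ≤
        2 * angularEnergy ι u s + circleInt (fun s θ => ‖hopfCoeff ι u s θ‖ₑ) s := by
    intro s hs
    have c2 := continuous_slice (contDiffOn_derivTheta hw).continuousOn hs
    refine (lintegral_mono fun θ => hpt s θ).trans_eq ?_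
    rw [lintegral_add_left (by fun_prop), lintegral_const_mul' _ _ (by simp)]
    rfl
  have hmeas : AEMeasurable (fun s => 2 * angularEnergy ι u s) (volume.restrict (Ioo a b)) := by
    have h1 : AEMeasurable (fun q => ENNReal.ofReal (circleSq (derivTheta (coordMap ι u)) q))
        (volume.restrict (Ioo a b)) :=
      ((continuousOn_circleSq (contDiffOn_derivTheta hw).continuousOn).aemeasurable
        measurableSet_Ioo).ennreal_ofReal
    refine AEMeasurable.const_mul (h1.congr ?_) 2
    filter_upwards [ae_restrict_mem measurableSet_Ioo] with q hq
    exact (ofReal_circleSq (continuous_slice (contDiffOn_derivTheta hw).continuousOn hq)).symm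
  calc energy ι u a b ≤ 2⁻¹ * ∫⁻ s in Ioo a b, (2 * angularEnergy ι u s
        + circleInt (fun s θ => ‖hopfCoeff ι u s θ‖ₑ) s) := by
        unfold energy cylInt
        exact mul_le_mul_right (setLIntegral_mono' measurableSet_Ioo hcirc) _
    _ = 2⁻¹ * (2 * (∫⁻ s in Ioo a b, angularEnergy ι u s)
        + cylInt (fun s θ => ‖hopfCoeff ι u s θ‖ₑ) a b) := by
        rw [lintegral_add_left' hmeas, lintegral_const_mul' _ _ (by simp)]
        rfl
    _ = _ := by
        unfold hopfL1
        have h4 : (4⁻¹ : ℝ≥0∞) * 2 = 2⁻¹ := by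
          rw [show (4 : ℝ≥0∞) = 2 * 2 by norm_num, ENNReal.mul_inv (by simp) (by simp), mul_assoc,
            ENNReal.inv_mul_cancel two_ne_zero ENNReal.ofNat_ne_top, mul_one]
        rw [mul_add, ← mul_assoc, ← mul_assoc, h4,
          ENNReal.inv_mul_cancel two_ne_zero ENNReal.ofNat_ne_top, one_mul]

variable {k' : ℕ} {ι' : N → EuclideanSpace ℝ (Fin k')} {a b c d : ℝ}

theorem energy_eq (hι : IsIsometricEmbedding G ι) (hι' : IsIsometricEmbedding G ι')
    (hu : ContMDiffOn (𝓘(ℝ, ℝ).prod (𝓡 1)) (𝓡 n) ∞ u (cylinder a b))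
    (hsub : Ioo c d ⊆ Ioo a b) : energy ι u c d = energy ι' u c d := by
  unfold energy
  congr 1
  refine cylInt_congr fun s hs θ => ?_
  rw [← ofReal_norm, ← ofReal_norm, norm_derivS_eq hι hι' hu (hsub hs),
    norm_derivTheta_eq hι hι' hu (hsub hs), ofReal_norm, ofReal_norm]

theorem tensionCircle_eq (hι : IsIsometricEmbedding G ι) (hι' : IsIsometricEmbedding G ι')
    (hu : ContMDiffOn (𝓘(ℝ, ℝ).prod (𝓡 1)) (𝓡 n) ∞ u (cylinder a b)) {s : ℝ}
    (hs : s ∈ Ioo a b) :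
    tensionCircle (n := n) ι u s = tensionCircle (n := n) ι' u s := by
  refine circleInt_congr fun θ => ?_
  rw [← ofReal_norm, norm_tension_eq hι hι' hu hs, ofReal_norm]

theorem tensionL2Sq_eq (hι : IsIsometricEmbedding G ι) (hι' : IsIsometricEmbedding G ι')
    (hu : ContMDiffOn (𝓘(ℝ, ℝ).prod (𝓡 1)) (𝓡 n) ∞ u (cylinder a b)) :
    tensionL2Sq (n := n) ι u a b = tensionL2Sq (n := n) ι' u a b :=
  setLIntegral_congr_fun measurableSet_Ioo fun _ hs => tensionCircle_eq hι hι' hu hs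

theorem angularEnergy_eq (hι : IsIsometricEmbedding G ι) (hι' : IsIsometricEmbedding G ι')
    (hu : ContMDiffOn (𝓘(ℝ, ℝ).prod (𝓡 1)) (𝓡 n) ∞ u (cylinder a b)) {s : ℝ}
    (hs : s ∈ Ioo a b) : angularEnergy ι u s = angularEnergy ι' u s := by
  refine circleInt_congr fun θ => ?_
  rw [← ofReal_norm, norm_derivTheta_eq hι hι' hu hs, ofReal_norm]

end Main

end AlmostHarmonicCylinder

end

open AlmostHarmonicCylinder in
theorem lemma2p1
    {n : ℕ} {N : Type*} [TopologicalSpace N] [T2Space N] [CompactSpace N]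
    [ChartedSpace (EuclideanSpace ℝ (Fin n)) N] [IsManifold (𝓡 n) ∞ N]
    (G : Bundle.ContMDiffRiemannianMetric (𝓡 n) ∞ (EuclideanSpace ℝ (Fin n))
      (fun x : N => TangentSpace (𝓡 n) x))
    (E₀ : ℝ≥0) :
    ∃ δ C : ℝ≥0, 0 < δ ∧ 0 < C ∧
      ∀ (k : ℕ) (ι : N → EuclideanSpace ℝ (Fin k)), IsIsometricEmbedding G ι →
      ∀ Λ : ℝ, 3 / 2 ≤ Λ →
      ∀ u : ℝ × Circle → N,
        ContMDiffOn (𝓘(ℝ, ℝ).prod (𝓡 1)) (𝓡 n) ∞ u (cylinder (-Λ) Λ) →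
        energy ι u (-Λ) Λ ≤ E₀ →
        (∀ s : ℝ, cylinder (s - 1) (s + 2) ⊆ cylinder (-Λ) Λ →
          energy ι u (s - 1) (s + 2) < δ) →
        tensionL2Sq (n := n) ι u (-Λ) Λ < δ →
        (∀ s ∈ Ioo (-Λ + 1) (Λ - 1),
          angularEnergy ι u s ≤ C * ENNReal.ofReal (Real.exp (|s| - Λ))
            + ∫⁻ q in Ioo (-Λ) Λ,
                ENNReal.ofReal (Real.exp (-|s - q|)) * tensionCircle (n := n) ι u q) ∧
        (∀ l : ℝ, 1 < l → l < Λ →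
          ∫⁻ s in Ioo (-Λ + l) (Λ - l), angularEnergy ι u s
            ≤ C * ENNReal.ofReal (Real.exp (-l)) + 2 * tensionL2Sq (n := n) ι u (-Λ) Λ) ∧
        (∀ l : ℝ, 1 < l → l < Λ →
          energy ι u (-(Λ - l)) (Λ - l)
            ≤ C * ENNReal.ofReal (Real.exp (-l)) + 2 * tensionL2Sq (n := n) ι u (-Λ) Λ
              + 4⁻¹ * hopfL1 ι u (-(Λ - l)) (Λ - l)) := by
  -- If no isometric embedding exists the claim is vacuous; otherwise one is fixed, and the
  -- constants come from it alone. This avoids invoking Nash's theorem.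
  by_cases hex : ∃ (k₀ : ℕ) (ι₀ : N → EuclideanSpace ℝ (Fin k₀)), IsIsometricEmbedding G ι₀
  swap
  · exact ⟨1, 1, one_pos, one_pos, fun k ι hι => absurd ⟨k, ι, hι⟩ hex⟩
  obtain ⟨k₀, ι₀, hι₀⟩ := hex
  obtain ⟨K, -, hK⟩ := exists_norm_sub_tangentProj_le hι₀
  have hden : 0 < 1296 * (K ^ 2 + 1) := by positivity
  -- Adding 1 to K² keeps the denominator positive when K = 0 and makes δ ≤ 1.
  set δ : ℝ := 1 / (1296 * (K ^ 2 + 1)) with hδdef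
  have hδ : 0 < δ := by positivity
  have hδ1 : δ ≤ 1 := by
    rw [hδdef, div_le_one hden]
    nlinarith [sq_nonneg K]
  have hKδ : K ^ 2 * δ ≤ 1 / 1296 := by
    rw [hδdef, mul_one_div, div_le_div_iff₀ hden (by norm_num)]
    linarith
  -- The factor ½ in the energy turns the bound δ/2 into ∫(|u_s|² + |u_θ|²) ≤ δ. The constant 624 is
  -- 2·312, the 2 coming from integrating e^{|s|-Λ} over both halves of the cylinder.
  refine ⟨(δ / 2).toNNReal, 624, Real.toNNReal_pos.2 (by positivity), by norm_num, ?_⟩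
  intro k ι hι Λ hΛ u hu _ hE hT
  have hdecay : ∀ s ∈ Ioo (-Λ + 1) (Λ - 1), angularEnergy ι u s ≤
      312 * ENNReal.ofReal (Real.exp (|s| - Λ)) + ∫⁻ q in Ioo (-Λ) Λ,
        ENNReal.ofReal (Real.exp (-|s - q|)) * tensionCircle (n := n) ι u q := by
    intro s hs
    -- The decay is proved for the fixed embedding, where K is available, and carried over to `ι`
    -- because every quantity in it is intrinsic.
    have h := angularEnergy_le hι₀ hK hδ hδ1 hKδ hΛ hu
      (fun r hr => by
        rw [energy_eq hι₀ hι hu fun x hx => (hr (mk_mem_prod hx (mem_univ (1 : Circle)))).1]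
        exact hE r hr)
      (by rw [tensionL2Sq_eq hι₀ hι hu]; exact hT) hs
    rw [angularEnergy_eq hι₀ hι hu ⟨by linarith [hs.1], by linarith [hs.2]⟩] at h
    refine h.trans_eq ?_
    congr 1
    refine MeasureTheory.setLIntegral_congr_fun measurableSet_Ioo fun q hq => ?_
    rw [tensionCircle_eq hι₀ hι hu hq]
  have hint := fun l hl hlΛ => lintegral_angularEnergy_le (l := l) hι hu hdecay hl hlΛ
  refine ⟨fun s hs => (hdecay s hs).trans ?_, fun l hl hlΛ => by simpa using hint l hl hlΛ,
    fun l hl hlΛ => ?_⟩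
  · gcongr
    norm_num
  · have hsub : cylinder (-(Λ - l)) (Λ - l) ⊆ cylinder (-Λ) Λ :=
      prod_mono (Ioo_subset_Ioo (by linarith) (by linarith)) le_rfl
    refine (energy_le_angularEnergy_add_hopfL1 hι (hu.mono hsub)).trans ?_
    gcongr
    have h := hint l hl hlΛ
    rw [show -Λ + l = -(Λ - l) by ring] at h
    simpa using h
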